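/- **Definitions.** All graphs are simple and labeled. For a graph $G$ and a vertex $v$, the local complementation $G*v$ replaces the subgraph of $G$ induced on the neighbourhood $N(v)$ by its complement; for an edge $uv$ the pivot is $G\times uv := G*u*v*u$. An *ordered bipartite graph* is a triple $G=(L,R,E)$ with $L,R$ disjoint sets and $E$ a set of edges each joining $L$ to $R$; its vertex set is $V(G)=L\cup R$. For an edge $uv\in E$ put $G\times uv := (L\mathbin{\triangle}\{u,v\},\,R\mathbin{\triangle}\{u,v\},\,E')$, where $E'$ is the edge set of the pivot at $uv$ of the underlying graph $(L\cup R,E)$. An ordered bipartite graph $H=(U_1,U_2,E_H)$ with $U_1\cup U_2\subseteq V(G)$ is a *pivot-minor of $G$ (in the ordered sense)* if $H$ (with exactly these vertices, sides and edges) is obtained from $G$ by a finite sequence of pivots at edges and vertex deletions. $G$ is *bipartite $k$-pivot-minor universal* if every ordered bipartite graph $H$ on any $k$ vertices of $V(G)$ (with any sides $U_1,U_2$ and any edges between them) is a pivot-minor of $G$. Let $\mathbb G(\ell,r,1/2)$ be the uniform distribution on ordered bipartite graphs with fixed sides $L,R$, $|L|=\ell$, $|R|=r$ (each edge between $L$ and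 $R$ is present independently with probability $1/2$). **Theorem.** Let $C=\frac{1}{2\log_2(8/7)}+\frac14$. For all $c>0$, if $\ell\ge r\ge(1+c)Ck^2$ and $\ell\le 2^{o(\sqrt r)}$, then $G\sim\mathbb G(\ell,r,1/2)$ is bipartite $k$-pivot-minor universal with probability at least $1-2^{-(1+o(1))ck^2/4}$. Here the asymptotic notation means the following; $c$ may be a constant or, more generally, may vary as long as it stays bounded below by a positive constant. Let $k_n,\ell_n,r_n$ be non-negative integers and $c_n, f_n$ real numbers ($n\in\mathbb N$) such that $c_n\ge c_0$ for all $n$ and some constant $c_0>0$, $r_n\to\infty$, $f_n=o(\sqrt{r_n})$, and, for all $n$, $$\ell_n\ \ge\ r_n\ \ge\ (1+c_n)\,C\,k_n^2,\qquad \ell_n\le 2^{f_n}.$$ Then there are real numbers $\eta_n\to0$ such that for every $n$ $$\Pr\big[\mathbb G(\ell_n,r_n,1/2)\text{ is bipartite }k_n\text{-pivot-minor universal}\big]\ \ge\ 1-2^{-(1+\eta_n)\,c_n k_n^2/4}.$$ (In particular this covers every constant $c>0$ and every regime with $k_n\to\infty$.) -/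

import Mathlib

open Filter Topology Asymptotics

/-- Local complementation `G * v`: the subgraph of `G` induced on the neighbourhood of `v` is
replaced by its complement. -/
def SimpleGraph.localCompl {V : Type*} (G : SimpleGraph V) (v : V) : SimpleGraph V where
  Adj x y := x ≠ y ∧ Xor (G.Adj x y) (G.Adj v x ∧ G.Adj v y)
  symm := ⟨fun x y h => by
    refine ⟨h.1.symm, ?_⟩
    rw [G.adj_comm y x, and_comm (a := G.Adj v y)]
    exact h.2⟩
  loopless := ⟨fun _ h => h.1 rfl⟩

/-- The graph `G * u * v * u`, which is the pivot `G × uv` when `uv` is an edge of `G`. -/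
def SimpleGraph.pivot {V : Type*} (G : SimpleGraph V) (u v : V) : SimpleGraph V :=
  ((G.localCompl u).localCompl v).localCompl u

/-- An ordered bipartite graph `(L, R, E)` whose vertices are taken from the type `V`. The vertex
set is `L ∪ R`; the sides `L` and `R` are disjoint and every edge joins `L` to `R`. Elements of `V`
outside `L ∪ R` are not vertices (they are isolated in `graph`), so that two ordered bipartite
graphs are equal if and only if they have the same sides and the same edges. -/
@[ext]
structure OrderedBipartiteGraph (V : Type*) where
  L : Set V
  R : Set V
  graph : SimpleGraph V
  isBipartiteWith : graph.IsBipartiteWith L R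

namespace OrderedBipartiteGraph

/-- The vertex set `V(G) = L(G) ∪ R(G)`. -/
def verts {V : Type*} (G : OrderedBipartiteGraph V) : Set V := G.L ∪ G.R

/-- The pivot `G × uv` of an ordered bipartite graph at an edge `uv`: the underlying graph is
pivoted at `uv`, and `u` and `v` change sides. -/
def pivot {V : Type*} (G : OrderedBipartiteGraph V) (u v : V) (h : G.graph.Adj u v) :
    OrderedBipartiteGraph V where
  L := symmDiff G.L {u, v}
  R := symmDiff G.R {u, v}
  graph := G.graph.pivot u v
  isBipartiteWith := by
    classical
    obtain ⟨hd, hm⟩ := G.isBipartiteWith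
    rw [Set.disjoint_left] at hd
    constructor
    · rw [Set.disjoint_left]
      intro x
      simp only [Set.mem_symmDiff, Set.mem_insert_iff, Set.mem_singleton_iff]
      have h1 := hm h
      by_cases hxu : x = u <;> by_cases hxv : x = v <;> grind
    · intro x y hxy
      have hs : ∀ a b, G.graph.Adj a b → G.graph.Adj b a := fun a b hab => hab.symm
      have hl : ∀ a, ¬ G.graph.Adj a a := fun a => G.graph.loopless.irrefl a
      simp only [SimpleGraph.pivot, SimpleGraph.localCompl, Xor] at hxy
      simp only [Set.mem_symmDiff, Set.mem_insert_iff, Set.mem_singleton_iff]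
      have h1 := hm h
      have hxy' := @hm x y
      have hux := @hm u x
      have huy := @hm u y
      have hvx := @hm v x
      have hvy := @hm v y
      have huv : u ≠ v := h.ne
      clear hm
      by_cases hxu : x = u <;> by_cases hxv : x = v <;> by_cases hyu : y = u <;>
        by_cases hyv : y = v <;> grind

/-- Deletion of the vertex `v`. -/
def deleteVertex {V : Type*} (G : OrderedBipartiteGraph V) (v : V) : OrderedBipartiteGraph V where
  L := G.L \ {v}
  R := G.R \ {v}
  graph := G.graph.deleteIncidenceSet v
  isBipartiteWith := by
    obtain ⟨hd, hm⟩ := G.isBipartiteWith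
    refine ⟨hd.mono Set.sdiff_subset Set.sdiff_subset, fun x y hxy => ?_⟩
    rw [SimpleGraph.deleteIncidenceSet_adj] at hxy
    have := hm hxy.1
    simp only [Set.mem_sdiff, Set.mem_singleton_iff]
    tauto

/-- One operation: a pivot at an edge, or the deletion of a vertex. -/
inductive Step {V : Type*} : OrderedBipartiteGraph V → OrderedBipartiteGraph V → Prop
  | pivot (G : OrderedBipartiteGraph V) (u v : V) (h : G.graph.Adj u v) : Step G (G.pivot u v h)
  | delete (G : OrderedBipartiteGraph V) (v : V) (h : v ∈ G.verts) : Step G (G.deleteVertex v)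

/-- `H` is a (labeled) pivot-minor of `G` in the ordered sense: `H` is obtained from `G` exactly,
sides included, by a finite sequence of pivots and vertex deletions. -/
def IsPivotMinor {V : Type*} (H G : OrderedBipartiteGraph V) : Prop :=
  Relation.ReflTransGen Step G H

/-- `G` is bipartite `k`-pivot-minor universal: every ordered bipartite graph on any `k` vertices
of `G` (with any sides and any edges between the sides) is a pivot-minor of `G`. -/
def IsPivotMinorUniversal {V : Type*} (k : ℕ) (G : OrderedBipartiteGraph V) : Prop :=
  ∀ H : OrderedBipartiteGraph V, H.verts ⊆ G.verts → H.verts.encard = k → H.IsPivotMinor G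

/-- The ordered bipartite graph with left side `Fin ℓ`, right side `Fin r` and edge set `E`. -/
def ofEdges {ℓ r : ℕ} (E : Finset (Fin ℓ × Fin r)) : OrderedBipartiteGraph (Fin ℓ ⊕ Fin r) where
  L := Set.range Sum.inl
  R := Set.range Sum.inr
  graph := SimpleGraph.fromRel fun x y => ∃ a b, (a, b) ∈ E ∧ x = Sum.inl a ∧ y = Sum.inr b
  isBipartiteWith := by
    refine ⟨Set.isCompl_range_inl_range_inr.disjoint, fun x y hxy => ?_⟩
    rw [SimpleGraph.fromRel_adj] at hxy
    rcases hxy.2 with ⟨a, b, -, rfl, rfl⟩ | ⟨a, b, -, rfl, rfl⟩ <;> simp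

/-- The distribution `𝔾(ℓ, r, 1/2)`: the uniform distribution on ordered bipartite graphs with left
side `Fin ℓ` and right side `Fin r`. -/
noncomputable def random (ℓ r : ℕ) : PMF (OrderedBipartiteGraph (Fin ℓ ⊕ Fin r)) :=
  (PMF.uniformOfFintype (Finset (Fin ℓ × Fin r))).map ofEdges

/-- The probability that `𝔾(ℓ, r, 1/2)` is bipartite `k`-pivot-minor universal. -/
noncomputable def probUniversal (ℓ r k : ℕ) : ℝ :=
  ((random ℓ r).toOuterMeasure {G | G.IsPivotMinorUniversal k}).toReal

end OrderedBipartiteGraph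

/-! Encode the graph by its biadjacency matrix `M` over 𝔽₂. Pivoting at an edge and deleting both
its ends is one step of row elimination, so eliminating linearly independent rows replaces `M` by a
Schur complement (`ofMatrix_eliminate_isPivotMinor`). Suppose first that the target lies on the
correct sides `S`, `T`, with prescribed matrix `D`. Put the spare rows in `X` and `m` spare columns
in `Y`, and cut `M` into independent uniform blocks: `A` on S × T, `B` on S × Y, `U` on X × T and
`C` on X × Y. Every basis of 𝔽₂^Y among the rows of `C` gives a right-supported left inverse `P` of
`C`, and the minor `A + B * P * U` is available. It suffices that one of these equals `D`.

Many bases come from splitting `X` into halves whose rows both span, which fails with probability at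
most 2 · 2^m / 2^n for halves of size n. Fix a basis in the first half, indexed by `Y`. For each
subset `I` of `Y`, complete the rows indexed by `I` to a basis using the second half
(`exists_isRowInverse_family`). Then `P I - P J` has rank at least max(|I \ J|, |J \ I|), hence at
least half of the symmetric difference.

A second moment argument shows that the 2^m candidates hit `D` (`prob_forall_add_mul_mul_ne_le`).
Given `U` and `B`, Cauchy-Schwarz bounds the chance that the uniform `A` misses in terms of
coincidences B(P I)U = B(P J)U. The expected number of coincidences is turned by duality into a sum
over T × S matrices `Z` of Pr[(P I - P J) U Z = 0], which decays with rank `Z`. Summing over `I` and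
`J` gives a binomial sum, and hence a bound exponentially small in `m`.

A target vertex on the wrong side is moved across by pivoting with a spare neighbour. Its row is
exposed first, and the rest of the pivoted matrix is still uniform
(`prob_not_isPivotMinor_le_of_switch`).

A union bound over at most (2(ℓ + r))^k 2^(k²/4) targets, with m ≈ 0.41 r and n ≈ r/2 - k, gives
failure probability at most 2^(-(r/(4C) - k²/4) + O(k(1 + f) + 1)). The hypothesis on `r` makes the
main exponent at least c k²/4 and at least a constant times `r`, while the error is o(r). -/

namespace OrderedBipartiteGraph

/-! ### Pivots and deletions as elimination over 𝔽₂ -/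

variable {V : Type*}

/-- The ordered bipartite graph with sides `L` and `R` and biadjacency matrix `M` over `𝔽₂`. -/
def ofMatrix (L R : Finset V) (h : Disjoint L R) (M : V → V → ZMod 2) :
    OrderedBipartiteGraph V where
  L := L
  R := R
  graph :=
    { Adj := fun x y => (x ∈ L ∧ y ∈ R ∧ M x y = 1) ∨ (y ∈ L ∧ x ∈ R ∧ M y x = 1)
      symm := ⟨fun _ _ hxy => hxy.symm⟩
      loopless := ⟨fun x hx => by
        rw [Finset.disjoint_left] at h
        rcases hx with hx | hx <;> exact h hx.1 hx.2.1⟩ }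
  isBipartiteWith := by
    refine ⟨by exact_mod_cast h, fun x y hxy => ?_⟩
    rcases hxy with hxy | hxy
    · exact Or.inl ⟨by simpa using hxy.1, by simpa using hxy.2.1⟩
    · exact Or.inr ⟨by simpa using hxy.2.1, by simpa using hxy.1⟩

theorem ofMatrix_congr {L R L' R' : Finset V} {h : Disjoint L R} {h' : Disjoint L' R'}
    {M M' : V → V → ZMod 2} (hL : L = L') (hR : R = R')
    (hM : ∀ x ∈ L, ∀ y ∈ R, M x y = M' x y) : ofMatrix L R h M = ofMatrix L' R' h' M' := by
  subst hL hR
  ext x y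
  · rfl
  · rfl
  · simp only [ofMatrix]
    constructor
    · rintro (⟨a, b, c⟩ | ⟨a, b, c⟩)
      · exact Or.inl ⟨a, b, hM _ a _ b ▸ c⟩
      · exact Or.inr ⟨a, b, hM _ a _ b ▸ c⟩
    · rintro (⟨a, b, c⟩ | ⟨a, b, c⟩)
      · exact Or.inl ⟨a, b, (hM _ a _ b).trans c⟩
      · exact Or.inr ⟨a, b, (hM _ a _ b).trans c⟩

theorem IsPivotMinor.trans {G₁ G₂ G₃ : OrderedBipartiteGraph V} (h : G₁.IsPivotMinor G₂)
    (h' : G₂.IsPivotMinor G₃) : G₁.IsPivotMinor G₃ :=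
  Relation.ReflTransGen.trans h' h

/-- Interchanging the two sides. -/
def swap (G : OrderedBipartiteGraph V) : OrderedBipartiteGraph V where
  L := G.R
  R := G.L
  graph := G.graph
  isBipartiteWith := G.isBipartiteWith.symm

theorem isPivotMinor_swap {H G : OrderedBipartiteGraph V} (h : H.IsPivotMinor G) :
    H.swap.IsPivotMinor G.swap := by
  refine Relation.ReflTransGen.lift (p := Step) OrderedBipartiteGraph.swap
    (fun A B hAB => ?_) _ _ h
  cases hAB with
  | pivot u v h => exact Step.pivot A.swap u v h
  | delete v h => exact Step.delete A.swap v (Or.symm h)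

theorem ofMatrix_swap (L R : Finset V) (h : Disjoint L R) (M : V → V → ZMod 2) :
    (ofMatrix L R h M).swap = ofMatrix R L h.symm (fun x y => M y x) := by
  ext x y
  · rfl
  · rfl
  · simp only [ofMatrix, swap]
    tauto

variable [DecidableEq V]

theorem deleteVertex_ofMatrix (L R : Finset V) (h : Disjoint L R) (M : V → V → ZMod 2) (v : V) :
    (ofMatrix L R h M).deleteVertex v =
      ofMatrix (L.erase v) (R.erase v)
        (h.mono (Finset.erase_subset _ _) (Finset.erase_subset _ _)) M := by
  ext x y
  · simp [deleteVertex, ofMatrix, and_comm]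
  · simp [deleteVertex, ofMatrix, and_comm]
  · simp only [deleteVertex, SimpleGraph.deleteIncidenceSet_adj]
    simp only [ofMatrix, Finset.mem_erase]
    tauto

theorem ofMatrix_erase_isPivotMinor (L R : Finset V) (h : Disjoint L R) (M : V → V → ZMod 2)
    (v : V) :
    (ofMatrix (L.erase v) (R.erase v)
        (h.mono (Finset.erase_subset _ _) (Finset.erase_subset _ _)) M).IsPivotMinor
      (ofMatrix L R h M) := by
  by_cases hv : v ∈ (ofMatrix L R h M).verts
  · rw [← deleteVertex_ofMatrix L R h]
    exact Relation.ReflTransGen.single (Step.delete _ _ hv)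
  · simp only [verts, ofMatrix, Set.mem_union, Finset.mem_coe, not_or] at hv
    rw [ofMatrix_congr (L' := L) (R' := R) (h' := h) (M' := M)
      (Finset.erase_eq_of_notMem hv.1) (Finset.erase_eq_of_notMem hv.2) (fun _ _ _ _ => rfl)]
    exact Relation.ReflTransGen.refl

theorem ofMatrix_sdiff_isPivotMinor (L R : Finset V) (h : Disjoint L R) (M : V → V → ZMod 2)
    (W : Finset V) :
    (ofMatrix (L \ W) (R \ W) (h.mono Finset.sdiff_subset Finset.sdiff_subset) M).IsPivotMinor
      (ofMatrix L R h M) := by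
  induction W using Finset.induction_on with
  | empty =>
    rw [ofMatrix_congr (L' := L) (R' := R) (h' := h) (M' := M)
      (by simp) (by simp) (fun _ _ _ _ => rfl)]
    exact Relation.ReflTransGen.refl
  | insert v W _ ih =>
    refine IsPivotMinor.trans ?_ ih
    rw [ofMatrix_congr (L' := (L \ W).erase v) (R' := (R \ W).erase v)
      (h' := (h.mono (Finset.sdiff_subset) (Finset.sdiff_subset)).mono (Finset.erase_subset _ _)
        (Finset.erase_subset _ _)) (M' := M)
      (by ext; simp; tauto) (by ext; simp; tauto) (fun _ _ _ _ => rfl)]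
    exact ofMatrix_erase_isPivotMinor _ _ _ _ _

theorem ofMatrix_subset_isPivotMinor {L R S T : Finset V} (h : Disjoint L R)
    (M : V → V → ZMod 2) (hS : S ⊆ L) (hT : T ⊆ R) :
    (ofMatrix S T (h.mono hS hT) M).IsPivotMinor (ofMatrix L R h M) := by
  have key := ofMatrix_sdiff_isPivotMinor L R h M ((L \ S) ∪ (R \ T))
  rw [Finset.disjoint_left] at h
  rwa [ofMatrix_congr (L' := S) (R' := T) (M' := M) ?_ ?_ (fun _ _ _ _ => rfl)] at key
  · ext x
    have := @h x; have := @hS x; have := @hT x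
    simp only [Finset.mem_sdiff, Finset.mem_union]; tauto
  · ext x
    have := @h x; have := @hS x; have := @hT x
    simp only [Finset.mem_sdiff, Finset.mem_union]; tauto

theorem zmod_two_add_eq_one (a b : ZMod 2) : a + b = 1 ↔ Xor (a = 1) (b = 1) := by
  revert a b; decide

theorem zmod_two_mul_eq_one (a b : ZMod 2) : a * b = 1 ↔ a = 1 ∧ b = 1 := by
  revert a b; decide

/-- Pivoting at the edge `uv` and deleting `v` moves `u` to the right side. -/
theorem ofMatrix_pivot_isPivotMinor {L R : Finset V} (h : Disjoint L R) (M : V → V → ZMod 2)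
    {u v : V} (hu : u ∈ L) (hv : v ∈ R) (huv : M u v = 1)
    (h' : Disjoint (L.erase u) (insert u (R.erase v))) :
    (ofMatrix (L.erase u) (insert u (R.erase v)) h'
      (fun x y => if y = u then M x v else M x y + M x v * M u y)).IsPivotMinor
      (ofMatrix L R h M) := by
  have hadj : (ofMatrix L R h M).graph.Adj u v := Or.inl ⟨hu, hv, huv⟩
  have hdel : v ∈ ((ofMatrix L R h M).pivot u v hadj).verts := by
    have h1 : v ∉ L := fun h2 => Finset.disjoint_left.1 h h2 hv
    simp [verts, pivot, ofMatrix, Set.mem_symmDiff, h1]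
  refine Relation.ReflTransGen.head (Step.pivot _ u v hadj) ?_
  have h0 := Step.delete _ v hdel
  convert Relation.ReflTransGen.single h0 using 1
  rw [Finset.disjoint_left] at h
  have huR := h hu
  have hvL : v ∉ L := fun h2 => h h2 hv
  have hne : u ≠ v := by rintro rfl; exact huR hv
  ext x y
  · simp only [ofMatrix, Finset.coe_erase, Set.mem_sdiff, Finset.mem_coe, Set.mem_singleton_iff,
      deleteVertex, pivot, Set.mem_symmDiff, Set.mem_insert_iff]
    have := @h x
    grind
  · simp only [ofMatrix, Finset.coe_insert, Finset.coe_erase, Set.mem_sdiff, Finset.mem_coe, Set.mem_singleton_iff,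
      deleteVertex, pivot, Set.mem_symmDiff, Set.mem_insert_iff]
    have := @h x
    grind
  · simp only [deleteVertex, SimpleGraph.deleteIncidenceSet_adj]
    simp only [pivot, SimpleGraph.pivot, SimpleGraph.localCompl]
    simp only [ofMatrix, Finset.mem_erase, Finset.mem_insert]
    have hx := @h x
    have hy := @h y
    by_cases hxv : x = v
    · grind
    by_cases hyv : y = v
    · grind
    by_cases hxu : x = u <;> by_cases hyu : y = u
    · grind
    · simp only [Xor]; grind [zmod_two_add_eq_one, zmod_two_mul_eq_one]
    · simp only [Xor]; grind [zmod_two_add_eq_one, zmod_two_mul_eq_one]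
    · simp only [hxu, hyu, if_false, zmod_two_add_eq_one, zmod_two_mul_eq_one, Xor]
      grind

/-- Pivoting at the edge `uv` and deleting both `u` and `v`. -/
theorem ofMatrix_pivot_erase_isPivotMinor {L R : Finset V} (h : Disjoint L R)
    (M : V → V → ZMod 2) {u v : V} (hu : u ∈ L) (hv : v ∈ R) (huv : M u v = 1) :
    (ofMatrix (L.erase u) (R.erase v)
      (h.mono (Finset.erase_subset _ _) (Finset.erase_subset _ _))
      (fun x y => M x y + M x v * M u y)).IsPivotMinor (ofMatrix L R h M) := by
  have hd : Disjoint (L.erase u) (insert u (R.erase v)) := by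
    rw [Finset.disjoint_left] at h ⊢
    intro x
    have := @h x
    simp only [Finset.mem_erase, Finset.mem_insert]
    tauto
  have huR := Finset.disjoint_left.1 h hu
  refine IsPivotMinor.trans ?_ (ofMatrix_pivot_isPivotMinor h M hu hv huv hd)
  have key := ofMatrix_subset_isPivotMinor hd
    (fun x y => if y = u then M x v else M x y + M x v * M u y) (Finset.Subset.refl _)
    (Finset.subset_insert u (R.erase v))
  rwa [ofMatrix_congr (M' := fun x y => M x y + M x v * M u y) rfl rfl ?_] at key
  intro x _ y hy
  rw [if_neg]
  rintro rfl
  exact huR (Finset.mem_of_mem_erase hy)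

/-- Schur complementation: if the rows in `X` are linearly independent on the columns in `Y`, then
they can be used to eliminate the columns in `Y`. -/
theorem ofMatrix_eliminate_isPivotMinor (X : Finset V) : ∀ {L R S T : Finset V} (Y : Finset V)
    (h : Disjoint L R) (hST : Disjoint S T) (M Q : V → V → ZMod 2), X ⊆ L → Y ⊆ R →
    S ⊆ L \ X → T ⊆ R \ Y →
    (∀ c : V → ZMod 2, (∀ y ∈ Y, ∑ x ∈ X, c x * M x y = 0) → ∀ x ∈ X, c x = 0) →
    (∀ s ∈ S, ∀ y ∈ Y, M s y = ∑ x ∈ X, Q s x * M x y) →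
    (ofMatrix S T hST (fun s t => M s t + ∑ x ∈ X, Q s x * M x t)).IsPivotMinor
      (ofMatrix L R h M) := by
  induction X using Finset.induction_on with
  | empty =>
    intro L R S T Y h hST M Q _ _ hS hT _ _
    convert ofMatrix_subset_isPivotMinor h M (hS.trans Finset.sdiff_subset)
      (hT.trans Finset.sdiff_subset) using 3
    simp
  | insert u X hu ih =>
    intro L R S T Y h hST M Q hX hY hS hT hind hQ
    -- By independence row `u` does not vanish on `Y`, so there is a pivot edge.
    obtain ⟨v, hv, huv⟩ : ∃ v ∈ Y, M u v = 1 := by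
      by_contra! hcon
      have h0 : ∀ y ∈ Y, M u y = 0 := fun y hy => by
        have := hcon y hy
        generalize M u y = a at this ⊢
        revert a; decide
      have := hind (fun x => if x = u then 1 else 0) (fun y hy => by simp [h0 y hy]) u (by simp)
      simp at this
    refine IsPivotMinor.trans ?_
      (ofMatrix_pivot_erase_isPivotMinor h M (hX (Finset.mem_insert_self _ _)) (hY hv) huv)
    -- The coefficients `Q` survive the pivot unchanged: column `v` of the relation for row `s`
    -- gives exactly the multiple of row `u` that the remaining reduced rows and row `s` absorb.
    have key := ih (Y.erase v) (h.mono (Finset.erase_subset u _) (Finset.erase_subset v _)) hST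
      (fun x y => M x y + M x v * M u y) Q ?_ (Finset.erase_subset_erase _ hY) ?_ ?_ ?_ ?_
    · convert key using 1
      refine ofMatrix_congr rfl rfl fun s hs t ht => ?_
      have h1 := hQ s hs v hv
      rw [Finset.sum_insert hu, huv, mul_one] at h1
      simp only [Finset.sum_insert hu, mul_add, Finset.sum_add_distrib, h1, ← mul_assoc,
        ← Finset.sum_mul, add_mul]
      linear_combination -(CharTwo.add_self_eq_zero ((∑ x ∈ X, Q s x * M x v) * M u t))
    · intro x hx
      exact Finset.mem_erase.2 ⟨by rintro rfl; exact hu hx, hX (Finset.mem_insert_of_mem hx)⟩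
    · intro x hx
      have := hS hx
      simp only [Finset.mem_sdiff, Finset.mem_insert, Finset.mem_erase] at this ⊢
      tauto
    · intro x hx
      have := hT hx
      simp only [Finset.mem_sdiff, Finset.mem_erase] at this ⊢
      refine ⟨⟨?_, this.1⟩, fun h => this.2 h.2⟩
      rintro rfl
      exact this.2 hv
    · intro c hc x hx
      have hxu : x ≠ u := by rintro rfl; exact hu hx
      -- A relation among reduced rows is one among the original rows; the coefficient of `u`
      -- collects the multiples added, and it cancels column `v` in characteristic 2.
      have := hind (fun z => if z = u then ∑ x ∈ X, c x * M x v else c z) (fun y hy => ?_) x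
        (Finset.mem_insert_of_mem hx)
      · simpa [hxu] using this
      · rw [Finset.sum_insert hu, if_pos rfl]
        have h2 : ∑ x ∈ X, (if x = u then ∑ x ∈ X, c x * M x v else c x) * M x y =
            ∑ x ∈ X, c x * M x y := by
          refine Finset.sum_congr rfl fun z hz => ?_
          rw [if_neg (by rintro rfl; exact hu hz)]
        rw [h2]
        by_cases hyv : y = v
        · subst hyv
          rw [huv, mul_one, CharTwo.add_self_eq_zero]
        · have := hc y (Finset.mem_erase.2 ⟨hyv, hy⟩)
          simp only [mul_add, Finset.sum_add_distrib, ← mul_assoc, ← Finset.sum_mul] at this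
          rw [add_comm, this]
    · intro s hs y hy
      have h1 := hQ s hs v hv
      have h2 := hQ s hs y (Finset.mem_of_mem_erase hy)
      rw [Finset.sum_insert hu, huv, mul_one] at h1
      rw [Finset.sum_insert hu] at h2
      simp only [mul_add, Finset.sum_add_distrib, h1, ← mul_assoc, h2,
        ← Finset.sum_mul, add_mul]
      linear_combination (CharTwo.add_self_eq_zero (Q s u * M u y))

end OrderedBipartiteGraph

/-! ### Uniform probability on finite types -/

section Prob

open scoped Classical in
/-- The proportion of the elements of a finite type that satisfy `p`. -/
noncomputable def prob {α : Type*} [Fintype α] (p : α → Prop) : ℝ :=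
  (Finset.univ.filter p).card / (Fintype.card α : ℝ)

variable {α β ι : Type*} [Fintype α] [Fintype β]

theorem prob_def (p : α → Prop) [DecidablePred p] :
    prob p = (Finset.univ.filter p).card / (Fintype.card α : ℝ) := by
  unfold prob
  congr!

theorem prob_mono {p q : α → Prop} (h : ∀ a, p a → q a) : prob p ≤ prob q := by
  classical
  unfold prob
  gcongr
  exact fun h' => h _ h'

theorem prob_le_one (p : α → Prop) : prob p ≤ 1 := by
  unfold prob
  refine div_le_one_of_le₀ ?_ (by positivity)
  exact_mod_cast Finset.card_le_univ _

theorem prob_eq_zero {p : α → Prop} (h : ∀ a, ¬ p a) : prob p = 0 := by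
  simp [prob, h]

theorem prob_or_le (p q : α → Prop) : prob (fun a => p a ∨ q a) ≤ prob p + prob q := by
  classical
  simp only [prob_def]
  rw [← add_div, Finset.filter_or]
  gcongr
  exact_mod_cast Finset.card_union_le _ _

theorem prob_exists_le [Fintype ι] (p : ι → α → Prop) :
    prob (fun a => ∃ i, p i a) ≤ ∑ i, prob (p i) := by
  classical
  simp only [prob_def]
  rw [← Finset.sum_div]
  gcongr
  have : (Finset.univ.filter fun a => ∃ i, p i a) =
      Finset.univ.biUnion fun i => Finset.univ.filter (p i) := by
    ext; simp
  rw [this]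
  exact_mod_cast Finset.card_biUnion_le

theorem prob_equiv (e : α ≃ β) (p : β → Prop) : prob (fun a => p (e a)) = prob p := by
  classical
  unfold prob
  rw [Fintype.card_congr e]
  congr 2
  refine Finset.card_bij (fun a _ => e a) (by simp) (by simp) fun b hb => ⟨e.symm b, ?_⟩
  simpa using hb

theorem prob_prod (p : α × β → Prop) :
    prob p = (∑ a, prob fun b => p (a, b)) / Fintype.card α := by
  classical
  simp only [prob_def]
  rw [← Finset.sum_div, div_div, Fintype.card_prod, Nat.cast_mul, mul_comm (Fintype.card α : ℝ)]
  congr 1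
  have : (Finset.univ.filter p).card = ∑ a, (Finset.univ.filter fun b => p (a, b)).card := by
    rw [Finset.card_filter, Fintype.sum_prod_type]
    simp only [Finset.card_filter]
  rw [this]
  push_cast
  rfl

theorem prob_prod_le [Nonempty α] {p : α × β → Prop} {C : ℝ}
    (h : ∀ a, prob (fun b => p (a, b)) ≤ C) : prob p ≤ C := by
  rw [prob_prod, div_le_iff₀ (by exact_mod_cast Fintype.card_pos)]
  refine (Finset.sum_le_sum fun a _ => h a).trans ?_
  simp [mul_comm]

/-- The image of the uniform distribution under a surjective homomorphism is uniform. -/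
theorem prob_comp_surjective [AddGroup α] [AddGroup β] (f : α →+ β) (hf : Function.Surjective f)
    (p : β → Prop) : prob (fun a => p (f a)) = prob p := by
  classical
  have hfib : ∀ b, (Finset.univ.filter fun a => f a = b).card =
      (Finset.univ.filter fun a => f a = 0).card := fun b =>
    AddMonoidHom.card_fiber_eq_of_mem_range f (hf b) (hf 0)
  have key : ∀ q : β → Prop, (Finset.univ.filter fun a => q (f a)).card =
      (Finset.univ.filter q).card * (Finset.univ.filter fun a => f a = 0).card := fun q => by
    rw [Finset.card_eq_sum_card_fiberwise (f := f) (t := Finset.univ.filter q)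
      (by intro a; simp)]
    rw [Finset.sum_const_nat (m := (Finset.univ.filter fun a => f a = 0).card)]
    intro b hb
    rw [← hfib b, Finset.filter_filter]
    congr 1
    ext a
    simp only [Finset.mem_filter, Finset.mem_univ, true_and] at hb ⊢
    exact ⟨fun h => h.2, fun h => ⟨h ▸ hb, h⟩⟩
  have hpos : 0 < (Finset.univ.filter fun a => f a = 0).card :=
    Finset.card_pos.2 ⟨0, by simp⟩
  have h1 := key p
  have h2 := key fun _ => True
  simp only [Finset.filter_true, Finset.card_univ] at h2
  unfold prob
  rw [h1, h2]
  push_cast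
  rw [mul_div_mul_right]
  exact_mod_cast hpos.ne'

/-- Restricting a uniform function along an injection gives a uniform function. -/
theorem prob_comp_injective {J A : Type*} [Fintype J] [Fintype A] [DecidableEq J] [DecidableEq A]
    [AddGroup β] (i : J → A) (hi : Function.Injective i) (p : (J → β) → Prop) :
    prob (fun M : A → β => p (M ∘ i)) = prob p := by
  refine prob_comp_surjective (α := A → β) (β := J → β)
    { toFun := fun M => M ∘ i, map_zero' := rfl, map_add' := fun _ _ => rfl } (fun g => ?_) p
  exact ⟨fun a => if h : ∃ j, i j = a then g h.choose else 0, by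
    ext j
    have : ∃ j', i j' = i j := ⟨j, rfl⟩
    simp only [AddMonoidHom.coe_mk, ZeroHom.coe_mk, Function.comp_apply, this, dif_pos]
    rw [hi this.choose_spec]⟩

end Prob

set_option linter.unusedSectionVars false

/-! ### Counting matrices over 𝔽₂ by rank -/

section Counting

variable {S T X Y : Type*} [Fintype S] [Fintype T] [Fintype X] [Fintype Y]
  [DecidableEq S] [DecidableEq T] [DecidableEq X] [DecidableEq Y]

theorem card_mulVec_eq_zero (W : Matrix Y T (ZMod 2)) :
    Fintype.card {w : T → ZMod 2 // W.mulVec w = 0} = 2 ^ (Fintype.card T - W.rank) := by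
  have h1 := LinearMap.finrank_range_add_finrank_ker W.mulVecLin
  rw [Module.finrank_fintype_fun_eq_card] at h1
  change W.rank + _ = _ at h1
  have := Fintype.ofFinite (LinearMap.ker W.mulVecLin)
  have h2 := Module.card_eq_pow_finrank (K := ZMod 2) (V := LinearMap.ker W.mulVecLin)
  rw [ZMod.card] at h2
  rw [← h1, Nat.add_sub_cancel_left, ← h2]
  refine Fintype.card_congr (Equiv.subtypeEquivRight fun w => ?_)
  simp

theorem card_vecMul_eq_zero (W : Matrix Y T (ZMod 2)) :
    Fintype.card {b : Y → ZMod 2 // Matrix.vecMul b W = 0} = 2 ^ (Fintype.card Y - W.rank) := by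
  rw [← W.rank_transpose, ← card_mulVec_eq_zero]
  refine Fintype.card_congr (Equiv.subtypeEquivRight fun w => ?_)
  rw [Matrix.mulVec_transpose]

theorem card_mul_eq_zero_left (W : Matrix Y T (ZMod 2)) :
    Fintype.card {B : Matrix S Y (ZMod 2) // B * W = 0} =
      (2 ^ (Fintype.card Y - W.rank)) ^ Fintype.card S := by
  rw [← card_vecMul_eq_zero, ← Fintype.card_fun]
  refine Fintype.card_congr (Equiv.trans (Equiv.subtypeEquivRight fun B => ?_)
    (Equiv.subtypePiEquivPi (p := fun _ b => Matrix.vecMul b W = 0)))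
  rw [← Matrix.ext_iff]
  simp only [funext_iff]
  rfl

theorem card_mul_eq_zero_right (W : Matrix Y T (ZMod 2)) :
    Fintype.card {Z : Matrix T S (ZMod 2) // W * Z = 0} =
      (2 ^ (Fintype.card T - W.rank)) ^ Fintype.card S := by
  rw [← card_mulVec_eq_zero, ← Fintype.card_fun]
  refine Fintype.card_congr (Equiv.trans
    (Equiv.subtypeEquiv (q := fun Z : S → T → ZMod 2 => ∀ s, W.mulVec (Z s) = 0)
      (Equiv.piComm _) fun Z => ?_)
    (Equiv.subtypePiEquivPi (p := fun _ b => W.mulVec b = 0)))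
  rw [← Matrix.ext_iff]
  simp only [funext_iff]
  exact forall_comm

theorem prob_eq_card_div {α : Type*} [Fintype α] (p : α → Prop) [Fintype {a // p a}] :
    prob p = Fintype.card {a // p a} / Fintype.card α := by
  classical
  unfold prob
  rw [Fintype.card_subtype]

theorem card_matrix (S T : Type*) [Fintype S] [Fintype T] [DecidableEq S] [DecidableEq T] :
    Fintype.card (Matrix S T (ZMod 2)) = 2 ^ (Fintype.card S * Fintype.card T) := by
  change Fintype.card (S → T → ZMod 2) = _
  rw [Fintype.card_fun, Fintype.card_fun, ZMod.card, ← pow_mul, mul_comm]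

/-- Both sides are 2 to the power |S| (|T| - rank W). This duality trades the random factor `B` for
a sum over `Z`, in which the other random factor can be averaged. -/
theorem two_pow_mul_prob_mul_eq_zero (W : Matrix Y T (ZMod 2)) :
    2 ^ (Fintype.card S * Fintype.card T) * prob (fun B : Matrix S Y (ZMod 2) => B * W = 0) =
      Fintype.card {Z : Matrix T S (ZMod 2) // W * Z = 0} := by
  have h1 : W.rank ≤ Fintype.card T := W.rank_le_card_width
  have h2 : W.rank ≤ Fintype.card Y := W.rank_le_card_height
  obtain ⟨t, ht⟩ := Nat.exists_eq_add_of_le h1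
  obtain ⟨y, hy⟩ := Nat.exists_eq_add_of_le h2
  rw [prob_eq_card_div, card_mul_eq_zero_left, card_mul_eq_zero_right, card_matrix, ht, hy,
    Nat.add_sub_cancel_left, Nat.add_sub_cancel_left]
  push_cast
  field_simp
  ring

theorem exists_mul_mul_eq_one (Z : Matrix T S (ZMod 2)) {j : ℕ} (h : j ≤ Z.rank) :
    ∃ (P : Matrix (Fin j) T (ZMod 2)) (G : Matrix S (Fin j) (ZMod 2)), P * Z * G = 1 := by
  obtain ⟨f, hf⟩ := exists_linearIndependent_of_le_finrank
    (R := ZMod 2) (M := LinearMap.range Z.mulVecLin) h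
  choose g hg using fun i => (f i).2
  let G : Matrix S (Fin j) (ZMod 2) := Matrix.of fun s i => g i s
  have hinj : LinearMap.ker (Z * G).mulVecLin = ⊥ := by
    have h1 : LinearIndependent (ZMod 2) (Z * G).col := by
      have h2 := hf.map' (Submodule.subtype _) (Submodule.ker_subtype _)
      have h3 : (Z * G).col = Submodule.subtype (LinearMap.range Z.mulVecLin) ∘ f := by
        ext i t
        rw [Function.comp_apply, Submodule.subtype_apply, ← hg i]
        rfl
      rw [h3]
      exact h2
    rw [← Matrix.mulVec_injective_iff] at h1
    exact LinearMap.ker_eq_bot.2 h1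
  obtain ⟨p, hp⟩ := LinearMap.exists_leftInverse_of_injective _ hinj
  refine ⟨LinearMap.toMatrix' p, G, ?_⟩
  have := congrArg LinearMap.toMatrix' hp
  rw [LinearMap.toMatrix'_comp, LinearMap.toMatrix'_id, ← Matrix.toLin'_apply',
    LinearMap.toMatrix'_toLin', ← Matrix.mul_assoc] at this
  exact this

theorem exists_eq_mul_of_rank_le (Z : Matrix T S (ZMod 2)) {j : ℕ} (h : Z.rank ≤ j) :
    ∃ (A : Matrix T (Fin j) (ZMod 2)) (B : Matrix (Fin j) S (ZMod 2)), Z = A * B := by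
  let b := Module.finBasis (ZMod 2) (LinearMap.range Z.mulVecLin)
  let c : Fin Z.rank → Fin j := Fin.castLE h
  let A : Matrix T (Fin Z.rank) (ZMod 2) := Matrix.of fun t i => (b i : T → ZMod 2) t
  let B : Matrix (Fin Z.rank) S (ZMod 2) := Matrix.of fun i s =>
    b.repr ⟨Z.mulVecLin (Pi.single s 1), LinearMap.mem_range_self _ _⟩ i
  have hAB : Z = A * B := by
    ext t s
    have h1 := congrArg (Submodule.subtype _)
      (b.sum_repr ⟨Z.mulVecLin (Pi.single s 1), LinearMap.mem_range_self _ _⟩)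
    rw [map_sum] at h1
    have h2 := congrFun h1 t
    rw [Finset.sum_apply] at h2
    have h3 : Z t s = Z.mulVecLin (Pi.single s 1) t := by simp
    rw [Matrix.mul_apply, h3]
    refine h2.symm.trans (Finset.sum_congr rfl fun i _ => ?_)
    exact mul_comm (b.repr ⟨Z.mulVecLin (Pi.single s 1), LinearMap.mem_range_self _ _⟩ i)
      ((b i : T → ZMod 2) t)
  -- `E` pads the inner dimension of the rank factorization from `Z.rank` to `j`.
  let E : Matrix (Fin Z.rank) (Fin j) (ZMod 2) := (1 : Matrix (Fin j) (Fin j) (ZMod 2)).submatrix c id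
  have hE : E * E.transpose = 1 := by
    ext x y
    simp [E, Matrix.mul_apply, Matrix.one_apply, c]
  refine ⟨A * E, E.transpose * B, ?_⟩
  rw [Matrix.mul_assoc, ← Matrix.mul_assoc E, hE, Matrix.one_mul, ← hAB]

theorem card_rank_le (j : ℕ) : Fintype.card {Z : Matrix T S (ZMod 2) // Z.rank ≤ j} ≤
    2 ^ (j * (Fintype.card S + Fintype.card T)) := by
  have : ∀ Z : {Z : Matrix T S (ZMod 2) // Z.rank ≤ j}, ∃ p : Matrix T (Fin j) (ZMod 2) ×
      Matrix (Fin j) S (ZMod 2), Z.1 = p.1 * p.2 := fun Z => by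
    obtain ⟨A, B, h⟩ := exists_eq_mul_of_rank_le Z.1 Z.2
    exact ⟨(A, B), h⟩
  choose f hf using this
  have := Fintype.card_le_of_injective f fun Z Z' h => Subtype.ext (by rw [hf, hf, h])
  rw [Fintype.card_prod, card_matrix, card_matrix, ← pow_add, Fintype.card_fin] at this
  convert this using 2
  ring

end Counting

/-! ### The second moment method -/

section SecondMoment

variable {S T X Y : Type*} [Fintype S] [Fintype T] [Fintype X] [Fintype Y]
  [DecidableEq S] [DecidableEq T] [DecidableEq X] [DecidableEq Y]

/-- Since `Z` has rank at least `j`, some `Z * G` has a left inverse, so `A * (Z * G)` is a uniform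
matrix with `j` columns. Each column must lie in the kernel of `K`, independently. -/
theorem prob_mul_mul_eq_zero_le (K : Matrix Y X (ZMod 2)) (Z : Matrix T S (ZMod 2)) {j : ℕ}
    (h : j ≤ Z.rank) : prob (fun A : Matrix X T (ZMod 2) => K * A * Z = 0) ≤
      (Fintype.card {v : X → ZMod 2 // K.mulVec v = 0} / 2 ^ Fintype.card X) ^ j := by
  obtain ⟨P, G, hPG⟩ := exists_mul_mul_eq_one Z h
  calc prob (fun A : Matrix X T (ZMod 2) => K * A * Z = 0)
      ≤ prob (fun A : Matrix X T (ZMod 2) => K * (A * (Z * G)) = 0) := prob_mono fun A hA => by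
        rw [← Matrix.mul_assoc, ← Matrix.mul_assoc, hA, Matrix.zero_mul]
    _ = prob (fun N : Matrix X (Fin j) (ZMod 2) => K * N = 0) :=
        prob_comp_surjective
          { toFun := fun A : Matrix X T (ZMod 2) => A * (Z * G)
            map_zero' := Matrix.zero_mul _
            map_add' := fun _ _ => Matrix.add_mul _ _ _ }
          (fun N => ⟨N * P, by
            change N * P * (Z * G) = N
            rw [Matrix.mul_assoc, ← Matrix.mul_assoc P, hPG, Matrix.mul_one]⟩)
          fun N => K * N = 0
    _ ≤ _ := by
        rw [prob_eq_card_div, card_mul_eq_zero_right, card_matrix, card_mulVec_eq_zero, div_pow,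
          Fintype.card_fin]
        push_cast
        rw [← pow_mul 2 (Fintype.card X)]

/-- Dualize in `B`, exchange the sums, and sort by the rank of `Z`: the zero matrix gives 1, the few
matrices of rank 1 or 2 cost `κ` each, and all others cost `κ ^ 3`. Cutting at rank 3 matters: in
the last term the decay must beat both the number of `Z` and the number of targets, and with the
later choice of `m` the bound `κ ^ 2` would be too weak. -/
theorem two_pow_mul_prob_le (K : Matrix Y X (ZMod 2)) {κ : ℝ}
    (hκ : (Fintype.card {v : X → ZMod 2 // K.mulVec v = 0} : ℝ) / 2 ^ Fintype.card X ≤ κ) :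
    2 ^ (Fintype.card S * Fintype.card T) *
        prob (fun p : Matrix X T (ZMod 2) × Matrix S Y (ZMod 2) => p.2 * (K * p.1) = 0) ≤
      1 + 2 ^ (2 * (Fintype.card S + Fintype.card T)) * κ +
        2 ^ (Fintype.card S * Fintype.card T) * κ ^ 3 := by
  have hκ0 : 0 ≤ κ := le_trans (by positivity) hκ
  have hle : ∀ (Z : Matrix T S (ZMod 2)) (j : ℕ), j ≤ Z.rank →
      prob (fun A : Matrix X T (ZMod 2) => K * A * Z = 0) ≤ κ ^ j := fun Z j hj =>
    (prob_mul_mul_eq_zero_le K Z hj).trans (pow_le_pow_left₀ (by positivity) hκ j)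
  have hsum : 2 ^ (Fintype.card S * Fintype.card T) *
      prob (fun p : Matrix X T (ZMod 2) × Matrix S Y (ZMod 2) => p.2 * (K * p.1) = 0) =
      ∑ Z : Matrix T S (ZMod 2), prob (fun A : Matrix X T (ZMod 2) => K * A * Z = 0) := by
    have h1 : ∀ A : Matrix X T (ZMod 2), 2 ^ (Fintype.card S * Fintype.card T) *
        prob (fun B : Matrix S Y (ZMod 2) => B * (K * A) = 0) =
        ∑ Z : Matrix T S (ZMod 2), if K * A * Z = 0 then (1 : ℝ) else 0 := fun A => by
      rw [two_pow_mul_prob_mul_eq_zero, Fintype.card_subtype, Finset.card_filter]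
      push_cast
      rfl
    rw [prob_prod, ← mul_div_assoc, Finset.mul_sum, Finset.sum_congr rfl fun A _ => h1 A,
      Finset.sum_comm, Finset.sum_div]
    refine Finset.sum_congr rfl fun Z _ => ?_
    rw [prob_def, Finset.card_filter]
    push_cast
    rfl
  rw [hsum]
  calc ∑ Z : Matrix T S (ZMod 2), prob (fun A : Matrix X T (ZMod 2) => K * A * Z = 0)
      ≤ ∑ Z : Matrix T S (ZMod 2),
          ((if Z = 0 then 1 else 0) + (if Z.rank ≤ 2 then κ else 0) + κ ^ 3) := by
        refine Finset.sum_le_sum fun Z _ => ?_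
        by_cases h0 : Z = 0
        · rw [if_pos h0]
          refine (prob_le_one _).trans ?_
          split_ifs <;> nlinarith [pow_nonneg hκ0 3]
        by_cases h2 : Z.rank ≤ 2
        · rw [if_pos h2, if_neg h0]
          have h1 : 1 ≤ Z.rank := by
            by_contra! hlt
            obtain ⟨A, B, hAB⟩ := exists_eq_mul_of_rank_le Z (Nat.lt_one_iff.1 hlt).le
            refine h0 ?_
            rw [hAB]
            ext
            simp [Matrix.mul_apply]
          have := hle Z 1 h1
          nlinarith [pow_nonneg hκ0 3]
        · rw [if_neg h2, if_neg h0]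
          have := hle Z 3 (by omega)
          linarith
    _ = 1 + (Fintype.card {Z : Matrix T S (ZMod 2) // Z.rank ≤ 2}) * κ +
          2 ^ (Fintype.card S * Fintype.card T) * κ ^ 3 := by
        rw [Finset.sum_add_distrib, Finset.sum_add_distrib, Fintype.sum_ite_eq',
          Finset.sum_const, Finset.card_univ, card_matrix, ← Finset.sum_filter, Finset.sum_const,
          Fintype.card_subtype, nsmul_eq_mul, nsmul_eq_mul, mul_comm (Fintype.card T)]
        push_cast
        rfl
    _ ≤ _ := by
        gcongr
        exact_mod_cast card_rank_le 2

/-- A uniform element avoids all the elements `D - Δ i` with a probability that is bounded by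
the number of coincidences among the `Δ i`. -/
theorem prob_forall_ne_le {ι α : Type*} [Fintype ι] [Nonempty ι] [Fintype α] [AddGroup α]
    [DecidableEq α] (Δ : ι → α) (D : α) :
    prob (fun A => ∀ i, A + Δ i ≠ D) ≤
      Fintype.card α * (Finset.univ.filter fun p : ι × ι => Δ p.1 = Δ p.2).card /
        (Fintype.card ι : ℝ) ^ 2 - 1 := by
  classical
  set im := Finset.univ.image Δ with him
  have hcard : (Finset.univ.filter fun A => ∀ i, A + Δ i ≠ D).card + im.card =
      Fintype.card α := by
    have h1 : im.card = (Finset.univ.filter fun A => ¬ ∀ i, A + Δ i ≠ D).card := by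
      rw [him]
      refine Finset.card_bij (fun z _ => D - z) ?_ ?_ ?_
      · simp only [Finset.mem_image, Finset.mem_univ, true_and, Finset.mem_filter, not_forall,
          not_not]
        rintro _ ⟨i, rfl⟩
        exact ⟨i, sub_add_cancel _ _⟩
      · intro _ _ _ _ h
        exact sub_right_injective h
      · simp only [Finset.mem_image, Finset.mem_univ, true_and, Finset.mem_filter, not_forall,
          not_not]
        rintro A ⟨i, rfl⟩
        exact ⟨Δ i, ⟨i, rfl⟩, by simp⟩
    rw [h1, Finset.card_filter_add_card_filter_not, Finset.card_univ]
  have hcs : (Fintype.card ι : ℝ) ^ 2 ≤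
      im.card * (Finset.univ.filter fun p : ι × ι => Δ p.1 = Δ p.2).card := by
    -- Cauchy-Schwarz on fibre sizes: few coincidences force a large image.
    have h1 : Fintype.card ι = ∑ z ∈ im, (Finset.univ.filter fun i => Δ i = z).card := by
      rw [← Finset.card_univ]
      exact Finset.card_eq_sum_card_fiberwise fun i _ => by simp [him]
    have h2 : (Finset.univ.filter fun p : ι × ι => Δ p.1 = Δ p.2).card =
        ∑ z ∈ im, (Finset.univ.filter fun i => Δ i = z).card ^ 2 := by
      rw [Finset.card_eq_sum_card_fiberwise (f := fun p : ι × ι => Δ p.1) (t := im)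
        (fun i _ => by simp [him])]
      refine Finset.sum_congr rfl fun z _ => ?_
      rw [sq, ← Finset.card_product]
      congr 1
      ext p
      simp only [Finset.mem_filter, Finset.mem_univ, true_and, Finset.mem_product]
      constructor
      · rintro ⟨h, h'⟩; exact ⟨h', h ▸ h'⟩
      · rintro ⟨h, h'⟩; exact ⟨h.trans h'.symm, h⟩
    rw [h1, h2]
    push_cast
    exact sq_sum_le_card_mul_sum_sq
  have hα : (0 : ℝ) < Fintype.card α := by exact_mod_cast Fintype.card_pos
  have hι : (0 : ℝ) < (Fintype.card ι : ℝ) ^ 2 := by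
    have : (0 : ℝ) < Fintype.card ι := by exact_mod_cast Fintype.card_pos
    positivity
  set c : ℝ := (((Finset.univ.filter fun p : ι × ι => Δ p.1 = Δ p.2).card : ℕ) : ℝ)
  have hprob : prob (fun A => ∀ i, A + Δ i ≠ D) = 1 - im.card / Fintype.card α := by
    rw [prob_def, eq_sub_iff_add_eq, ← add_div, div_eq_one_iff_eq hα.ne']
    exact_mod_cast hcard
  have him0 : (0 : ℝ) < im.card := by
    have : im.Nonempty := by rw [him]; exact Finset.univ_nonempty.image _
    exact_mod_cast this.card_pos
  rw [hprob]
  have hx : 0 < im.card / (Fintype.card α : ℝ) := by positivity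
  have h1 : (im.card / (Fintype.card α : ℝ))⁻¹ ≤ Fintype.card α * c / (Fintype.card ι : ℝ) ^ 2 := by
    rw [inv_div, div_le_div_iff₀ him0 hι]
    nlinarith
  -- For the density y of the image, 1 - y ≤ 1/y - 1; the result is linear in the number of
  -- coincidences, so it can be averaged directly.
  have h2 : 2 ≤ im.card / (Fintype.card α : ℝ) + (im.card / (Fintype.card α : ℝ))⁻¹ := by
    have := sq_nonneg (im.card / (Fintype.card α : ℝ) - 1)
    rw [← sub_nonneg]
    have h3 : im.card / (Fintype.card α : ℝ) + (im.card / (Fintype.card α : ℝ))⁻¹ - 2 =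
        (im.card / (Fintype.card α : ℝ) - 1) ^ 2 / (im.card / (Fintype.card α : ℝ)) := by
      field_simp
      ring
    rw [h3]
    positivity
  linarith

/-- For fixed `I`, the map J ↦ I ∆ J permutes the subsets, which leaves the binomial theorem. -/
theorem sum_pow_card_symmDiff {β : Type*} [Fintype β] [DecidableEq β] (x : ℝ) :
    ∑ I : Finset β, ∑ J : Finset β, x ^ (symmDiff I J).card =
      2 ^ Fintype.card β * (1 + x) ^ Fintype.card β := by
  have h1 : ∀ I : Finset β, ∑ J : Finset β, x ^ (symmDiff I J).card =
      (1 + x) ^ Fintype.card β := fun I => by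
    have hb : Function.Bijective fun J : Finset β => symmDiff I J :=
      Function.Involutive.bijective fun J => symmDiff_symmDiff_cancel_left I J
    rw [hb.sum_comp fun J : Finset β => x ^ J.card, add_comm,
      ← Fintype.sum_pow_mul_eq_add_pow]
    simp
  rw [Finset.sum_congr rfl fun I _ => h1 I, Finset.sum_const, Finset.card_univ, Fintype.card_finset,
    nsmul_eq_mul]
  push_cast
  rfl

/-- The second moment bound: if the matrices `P I`, indexed by the subsets `I` of a finite type,
have pairwise differences of large rank, then `A + B * P I * C` attains every prescribed value
with high probability. -/
theorem prob_forall_add_mul_mul_ne_le {β : Type*} [Fintype β] [DecidableEq β]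
    (P : Finset β → Matrix Y X (ZMod 2))
    (hP : ∀ I J, Fintype.card {v : X → ZMod 2 // (P I - P J).mulVec v = 0} * 2 ^ (I \ J).card ≤
      2 ^ Fintype.card X) (D : Matrix S T (ZMod 2)) {x : ℝ} (hx : 0 ≤ x) (hx2 : x ^ 2 = 1 / 2) :
    prob (fun p : (Matrix X T (ZMod 2) × Matrix S Y (ZMod 2)) × Matrix S T (ZMod 2) =>
        ∀ I, p.2 + p.1.2 * (P I * p.1.1) ≠ D) ≤
      2 ^ (2 * (Fintype.card S + Fintype.card T)) * ((1 + x) / 2) ^ Fintype.card β +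
        2 ^ (Fintype.card S * Fintype.card T) * ((1 + x ^ 3) / 2) ^ Fintype.card β := by
  have hκ : ∀ I J, (Fintype.card {v : X → ZMod 2 // (P I - P J).mulVec v = 0} : ℝ) /
      2 ^ Fintype.card X ≤ x ^ (symmDiff I J).card := fun I J => by
    set q : ℝ := (Fintype.card {v : X → ZMod 2 // (P I - P J).mulVec v = 0} : ℝ) /
      2 ^ Fintype.card X with hq
    have h1 : q * 2 ^ (I \ J).card ≤ 1 := by
      rw [hq, div_mul_eq_mul_div, div_le_one (by positivity)]
      exact_mod_cast hP I J
    have h2 : q * 2 ^ (J \ I).card ≤ 1 := by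
      rw [hq, div_mul_eq_mul_div, div_le_one (by positivity)]
      have : Fintype.card {v : X → ZMod 2 // (P I - P J).mulVec v = 0} =
          Fintype.card {v : X → ZMod 2 // (P J - P I).mulVec v = 0} :=
        Fintype.card_congr (Equiv.subtypeEquivRight fun v => by
          rw [← neg_sub (P J), Matrix.neg_mulVec, neg_eq_zero])
      rw [this]
      exact_mod_cast hP J I
    have h3 : (symmDiff I J).card = (I \ J).card + (J \ I).card := by
      rw [symmDiff_def, Finset.sup_eq_union, Finset.card_union_of_disjoint disjoint_sdiff_sdiff]
    have hq0 : 0 ≤ q := by positivity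
    -- Multiply the bounds for (I, J) and (J, I): the square of the kernel density is at most 2 to
    -- the power -|I ∆ J|, which is why `x` is a square root of 1/2.
    refine (sq_le_sq₀ hq0 (by positivity)).1 ?_
    rw [← pow_mul, mul_comm, pow_mul, hx2, h3, one_div, inv_pow, pow_add,
      ← one_div, le_div_iff₀ (by positivity)]
    calc q ^ 2 * (2 ^ (I \ J).card * 2 ^ (J \ I).card)
        = (q * 2 ^ (I \ J).card) * (q * 2 ^ (J \ I).card) := by ring
      _ ≤ 1 * 1 := by gcongr
      _ = 1 := by ring
  set a := Fintype.card S
  set b := Fintype.card T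
  set m := Fintype.card β
  set N : ℝ := (Fintype.card (Matrix X T (ZMod 2) × Matrix S Y (ZMod 2)) : ℝ) with hN
  have hN0 : 0 < N := by
    rw [hN]; exact_mod_cast Fintype.card_pos
  have hpair : ∀ I J, 2 ^ (a * b) * prob (fun p : Matrix X T (ZMod 2) × Matrix S Y (ZMod 2) =>
      p.2 * (P I * p.1) = p.2 * (P J * p.1)) ≤ 1 + 2 ^ (2 * (a + b)) * x ^ (symmDiff I J).card +
        2 ^ (a * b) * (x ^ 3) ^ (symmDiff I J).card := fun I J => by
    have := two_pow_mul_prob_le (S := S) (T := T) (P I - P J) (hκ I J)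
    rw [pow_right_comm x 3]
    have he : (fun p : Matrix X T (ZMod 2) × Matrix S Y (ZMod 2) =>
        p.2 * (P I * p.1) = p.2 * (P J * p.1)) = fun p =>
          p.2 * ((P I - P J) * p.1) = (0 : Matrix S T (ZMod 2)) := by
      ext p
      rw [Matrix.sub_mul, Matrix.mul_sub, sub_eq_zero]
    rw [he]
    exact this
  have hswap : ∑ q : Matrix X T (ZMod 2) × Matrix S Y (ZMod 2),
      ((Finset.univ.filter fun p : Finset β × Finset β =>
        q.2 * (P p.1 * q.1) = q.2 * (P p.2 * q.1)).card : ℝ) / N =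
      ∑ I, ∑ J, prob (fun q : Matrix X T (ZMod 2) × Matrix S Y (ZMod 2) =>
        q.2 * (P I * q.1) = q.2 * (P J * q.1)) := by
    simp only [prob_def, ← Finset.sum_div, Finset.card_filter]
    congr 1
    push_cast
    simp only [Fintype.sum_prod_type (α₁ := Finset β)]
    rw [Finset.sum_comm]
    refine Finset.sum_congr rfl fun I _ => ?_
    rw [Finset.sum_comm]
  rw [prob_prod, ← hN]
  calc (∑ q : Matrix X T (ZMod 2) × Matrix S Y (ZMod 2), prob fun A => ∀ I,
          A + q.2 * (P I * q.1) ≠ D) / N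
      ≤ (∑ q : Matrix X T (ZMod 2) × Matrix S Y (ZMod 2), ((2 : ℝ) ^ (a * b) *
          ((Finset.univ.filter fun p : Finset β × Finset β =>
            q.2 * (P p.1 * q.1) = q.2 * (P p.2 * q.1)).card : ℕ) / 4 ^ m - 1)) / N := by
        refine div_le_div_of_nonneg_right (Finset.sum_le_sum fun q _ => ?_) hN0.le
        have h1 := prob_forall_ne_le (fun I => q.2 * (P I * q.1)) D
        have h4 : ((2 : ℝ) ^ m) ^ 2 = 4 ^ m := by
          rw [← pow_mul, mul_comm, pow_mul]; norm_num
        rw [card_matrix, Fintype.card_finset] at h1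
        push_cast at h1
        rwa [h4] at h1
    _ = 2 ^ (a * b) / 4 ^ m * (∑ q : Matrix X T (ZMod 2) × Matrix S Y (ZMod 2),
          ((Finset.univ.filter fun p : Finset β × Finset β =>
            q.2 * (P p.1 * q.1) = q.2 * (P p.2 * q.1)).card : ℝ) / N) - 1 := by
        rw [Finset.sum_sub_distrib, Finset.sum_const, Finset.card_univ, nsmul_eq_mul, mul_one,
          sub_div, ← hN, div_self hN0.ne', Finset.mul_sum, Finset.sum_div]
        congr 1
        refine Finset.sum_congr rfl fun q _ => ?_
        ring
    _ = (∑ I, ∑ J, 2 ^ (a * b) * prob (fun q : Matrix X T (ZMod 2) × Matrix S Y (ZMod 2) =>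
          q.2 * (P I * q.1) = q.2 * (P J * q.1))) / 4 ^ m - 1 := by
        rw [hswap]
        simp only [← Finset.mul_sum]
        ring
    _ ≤ (∑ I : Finset β, ∑ J : Finset β, (1 + 2 ^ (2 * (a + b)) * x ^ (symmDiff I J).card +
        2 ^ (a * b) * (x ^ 3) ^ (symmDiff I J).card)) / 4 ^ m - 1 := by
        gcongr with I _ J _
        exact hpair I J
    _ = _ := by
        have h4 : (4 : ℝ) ^ m = 2 ^ m * 2 ^ m := by rw [← mul_pow]; norm_num
        simp only [Finset.sum_add_distrib, ← Finset.mul_sum, sum_pow_card_symmDiff,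
          Finset.sum_const, Finset.card_univ, Fintype.card_finset, nsmul_eq_mul, mul_one]
        push_cast
        rw [h4, div_pow, div_pow]
        field_simp
        ring

end SecondMoment

/-! ### Families of row bases and elimination of a random matrix -/

section Core

variable {S T X Y X₁ X₂ : Type*} [Fintype S] [Fintype T] [Fintype X] [Fintype Y]
  [Fintype X₁] [Fintype X₂] [DecidableEq S] [DecidableEq T] [DecidableEq X] [DecidableEq Y]
  [DecidableEq X₁] [DecidableEq X₂]

/-- `P` inverts the matrix `C` by means of the rows in `b`, which are linearly independent. -/
structure IsRowInverse (C : Matrix X Y (ZMod 2)) (b : Finset X) (P : Matrix Y X (ZMod 2)) :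
    Prop where
  indep : ∀ c : X → ZMod 2, (∀ x ∉ b, c x = 0) → Matrix.vecMul c C = 0 → c = 0
  mul_eq : P * C = 1
  support : ∀ y, ∀ x ∉ b, P y x = 0

/-- Extend `s` to a basis `b` inside `t`. The rows of `P` are the coordinates of the unit vectors in
the basis `b`, extended by zero. -/
theorem exists_isRowInverse (C : Matrix X Y (ZMod 2)) (s t : Set X) (hst : s ⊆ t)
    (hs : LinearIndepOn (ZMod 2) C.row s) (ht : Submodule.span (ZMod 2) (C.row '' t) = ⊤) :
    ∃ (b : Finset X) (P : Matrix Y X (ZMod 2)), s ⊆ b ∧ (b : Set X) ⊆ t ∧ IsRowInverse C b P := by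
  classical
  obtain ⟨b, hbt, hsb, hspan, hind⟩ := exists_linearIndepOn_extension hs hst
  have htop : Submodule.span (ZMod 2) (C.row '' (b.toFinset : Set X)) = ⊤ := by
    rw [Set.coe_toFinset, eq_top_iff, ← ht]
    exact Submodule.span_le.2 hspan
  have hmem : ∀ y : Y, ∃ c : X → ZMod 2, ∑ x ∈ b.toFinset, c x • C.row x = Pi.single y 1 := fun y => by
    rw [← Submodule.mem_span_image_finset_iff_exists_fun', htop]
    exact Submodule.mem_top
  choose c hc using hmem
  refine ⟨b.toFinset, Matrix.of fun y x => if x ∈ b.toFinset then c y x else 0, by simpa using hsb,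
    by simpa using hbt, ?_, ?_, ?_⟩
  · intro d hd hd0
    have := linearIndepOn_iff'.1 hind b.toFinset d (by simp) (by
      rw [Matrix.vecMul_eq_sum] at hd0
      rw [← hd0]
      refine Finset.sum_subset (Finset.subset_univ _) fun x _ hx => ?_
      exact (congrArg (· • C.row x) (hd x hx)).trans (zero_smul _ _))
    ext x
    by_cases hx : x ∈ b.toFinset
    · exact this x hx
    · exact hd x hx
  · ext y y'
    have := congrFun (hc y) y'
    rw [Finset.sum_apply] at this
    rw [Matrix.mul_apply, Matrix.one_apply]
    simp only [Matrix.of_apply, ite_mul, zero_mul]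
    rw [← Finset.sum_filter, Finset.filter_mem_eq_inter, Finset.univ_inter]
    simp only [Pi.smul_apply, smul_eq_mul] at this
    refine this.trans ?_
    rw [Pi.single_apply]
    simp only [eq_comm]
  · intro y x hx
    simp only [Matrix.of_apply, if_neg hx]

/-- For x in `b`, row x of `C * P - 1` is supported in `b` and annihilated by `C`, hence zero. So `C
* P` recovers the entries in `b` of any vector, and `P` is injective on vectors supported there. -/
theorem IsRowInverse.eq_zero {C : Matrix X Y (ZMod 2)} {b : Finset X} {P : Matrix Y X (ZMod 2)}
    (h : IsRowInverse C b P) {v : X → ZMod 2} (hv : ∀ x ∉ b, v x = 0) (hP : P.mulVec v = 0) :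
    v = 0 := by
  ext x
  by_cases hx : x ∈ b
  · have h1 : (C * P - 1 : Matrix X X (ZMod 2)) x = 0 := by
      refine h.indep _ (fun x' hx' => ?_) ?_
      · have hne : x ≠ x' := by rintro rfl; exact hx' hx
        rw [Matrix.sub_apply, Matrix.one_apply_ne hne, sub_zero, Matrix.mul_apply]
        exact Finset.sum_eq_zero fun y _ => by rw [h.support y x' hx', mul_zero]
      · have h2 : (C * P - 1 : Matrix X X (ZMod 2)) * C = 0 := by
          rw [Matrix.sub_mul, Matrix.mul_assoc, h.mul_eq, Matrix.mul_one, Matrix.one_mul, sub_self]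
        exact congrFun h2 x
    have h3 : ((C * P - 1 : Matrix X X (ZMod 2)).mulVec v) x = 0 := by
      change (C * P - 1 : Matrix X X (ZMod 2)) x ⬝ᵥ v = 0
      rw [h1, zero_dotProduct]
    rw [Matrix.sub_mulVec, ← Matrix.mulVec_mulVec, hP, Matrix.mulVec_zero, Matrix.one_mulVec,
      zero_sub, Pi.neg_apply, neg_eq_zero] at h3
    exact h3
  · exact hv x hx

/-- On vectors supported in `g '' I` the matrix `P'` vanishes while `P` is injective. Hence this
coordinate subspace meets the kernel of `P - P'` trivially, and adding the two spaces is injective.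
-/
theorem card_ker_sub_mul_le {C : Matrix X Y (ZMod 2)} {b b' : Finset X}
    {P P' : Matrix Y X (ZMod 2)} (h : IsRowInverse C b P) (h' : IsRowInverse C b' P')
    {β : Type*} (g : β → X) (hg : Function.Injective g) (I : Finset β)
    (hI : ∀ i ∈ I, g i ∈ b ∧ g i ∉ b') :
    Fintype.card {v : X → ZMod 2 // (P - P').mulVec v = 0} * 2 ^ I.card ≤ 2 ^ Fintype.card X := by
  classical
  have hcard : Fintype.card ({v : X → ZMod 2 // (P - P').mulVec v = 0} × (I → ZMod 2)) =
      Fintype.card {v : X → ZMod 2 // (P - P').mulVec v = 0} * 2 ^ I.card := by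
    rw [Fintype.card_prod, Fintype.card_fun, ZMod.card, Fintype.card_coe]
  have hcard' : Fintype.card (X → ZMod 2) = 2 ^ Fintype.card X := by
    rw [Fintype.card_fun, ZMod.card]
  have hgI : Function.Injective fun i : I => g i := fun i j hij => Subtype.ext (hg hij)
  let e : (I → ZMod 2) → X → ZMod 2 := fun w => Function.extend (fun i : I => g i) w 0
  have he : ∀ (w : I → ZMod 2) (i : I), e w (g i) = w i := fun w i => hgI.extend_apply w 0 i
  have he0 : ∀ (w : I → ZMod 2) (x : X), (¬ ∃ i : I, g i = x) → e w x = 0 := fun w x hx =>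
    Function.extend_apply' (f := fun i : I => g i) w (0 : X → ZMod 2) x hx
  rw [← hcard, ← hcard']
  refine Fintype.card_le_of_injective (fun p => p.1.1 + e p.2) ?_
  rintro ⟨⟨v, hv⟩, w⟩ ⟨⟨v', hv'⟩, w'⟩ heq
  simp only at heq
  have hu : v - v' = e w' - e w := by
    rw [sub_eq_sub_iff_add_eq_add, heq, add_comm]
  have hsupp : ∀ x, (¬ ∃ i : I, g i = x) → (v - v') x = 0 := fun x hx => by
    rw [hu, Pi.sub_apply, he0 _ _ hx, he0 _ _ hx, sub_zero]
  have hker : (P - P').mulVec (v - v') = 0 := by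
    rw [Matrix.mulVec_sub, hv, hv', sub_zero]
  have hP' : P'.mulVec (v - v') = 0 := by
    ext y
    refine Finset.sum_eq_zero fun x _ => ?_
    by_cases hx : ∃ i : I, g i = x
    · obtain ⟨i, rfl⟩ := hx
      exact (congrArg (· * (v - v') (g i)) (h'.support y _ (hI i i.2).2)).trans (zero_mul _)
    · rw [hsupp x hx, mul_zero]
  rw [Matrix.sub_mulVec, hP', sub_zero] at hker
  have h0 : v - v' = 0 := h.eq_zero (fun x hx => hsupp x (by
    rintro ⟨i, rfl⟩
    exact hx (hI i i.2).1)) hker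
  have hw : w = w' := by
    ext i
    rw [hu, sub_eq_zero] at h0
    rw [← he w, ← he w', h0]
  rw [sub_eq_zero] at h0
  subst h0 hw
  rfl

theorem exists_linearIndependent_rows (C : Matrix X Y (ZMod 2))
    (hC : Submodule.span (ZMod 2) (Set.range C.row) = ⊤) :
    ∃ g : Y → X, LinearIndependent (ZMod 2) fun y => C.row (g y) := by
  classical
  obtain ⟨κ, a, _, hspan, hind⟩ := exists_linearIndependent' (ZMod 2) C.row
  rw [hC] at hspan
  have B : Module.Basis κ (ZMod 2) (Y → ZMod 2) := Module.Basis.mk hind hspan.ge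
  let e : Y ≃ κ := (Pi.basisFun (ZMod 2) Y).indexEquiv B
  exact ⟨a ∘ e, hind.comp e e.injective⟩

/-- Two disjoint spanning sets of rows yield a large family of bases. -/
theorem exists_isRowInverse_family (C : Matrix (X₁ ⊕ X₂) Y (ZMod 2))
    (h₁ : Submodule.span (ZMod 2) (Set.range fun x => C.row (Sum.inl x)) = ⊤)
    (h₂ : Submodule.span (ZMod 2) (Set.range fun x => C.row (Sum.inr x)) = ⊤) :
    ∃ (b : Finset Y → Finset (X₁ ⊕ X₂)) (P : Finset Y → Matrix Y (X₁ ⊕ X₂) (ZMod 2)),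
      (∀ I, IsRowInverse C (b I) (P I)) ∧
      ∀ I J, Fintype.card {v : X₁ ⊕ X₂ → ZMod 2 // (P I - P J).mulVec v = 0} * 2 ^ (I \ J).card ≤
        2 ^ Fintype.card (X₁ ⊕ X₂) := by
  classical
  obtain ⟨g, hg⟩ := exists_linearIndependent_rows (fun x => C.row (Sum.inl x)) h₁
  have hginj : Function.Injective g := fun y y' h => hg.injective (by simp [h])
  have hinj : Function.Injective (Sum.inl ∘ g : Y → X₁ ⊕ X₂) := Sum.inl_injective.comp hginj
  have hmain : ∀ I : Finset Y, ∃ (b : Finset (X₁ ⊕ X₂)) (P : Matrix Y (X₁ ⊕ X₂) (ZMod 2)),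
      (Sum.inl ∘ g) '' (I : Set Y) ⊆ (b : Set (X₁ ⊕ X₂)) ∧
      (b : Set (X₁ ⊕ X₂)) ⊆ (Sum.inl ∘ g) '' (I : Set Y) ∪ Set.range Sum.inr ∧
      IsRowInverse C b P := fun I => by
    -- The basis may use, from the first half, only the rows indexed by `I`; hence the rows indexed
    -- by I \ J lie in `b I` and not in `b J`.
    refine exists_isRowInverse C ((Sum.inl ∘ g) '' (I : Set Y)) _ Set.subset_union_left ?_ ?_
    · exact LinearIndepOn.image_of_comp _ _
        ((linearIndepOn_univ_iff.2 hg).mono (Set.subset_univ (I : Set Y)))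
    · rw [eq_top_iff, ← h₂]
      refine Submodule.span_mono ?_
      rintro _ ⟨x, rfl⟩
      exact ⟨Sum.inr x, Or.inr ⟨x, rfl⟩, rfl⟩
  choose b P h1 h2 h3 using hmain
  refine ⟨b, P, h3, fun I J => ?_⟩
  refine card_ker_sub_mul_le (h3 I) (h3 J) _ hinj (I \ J) fun i hi => ?_
  rw [Finset.mem_sdiff] at hi
  refine ⟨h1 I ⟨i, hi.1, rfl⟩, fun h => ?_⟩
  rcases h2 J h with ⟨j, hj, hij⟩ | ⟨j, hj⟩
  · exact hi.2 (hinj hij ▸ hj)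
  · cases hj

/-- If the rows do not span, some nonzero `w` is orthogonal to all of them. Each fixed nonzero `w`
has this property with probability 2 to the power -|X|. -/
theorem prob_span_rows_ne_top_le :
    prob (fun C : Matrix X Y (ZMod 2) => Submodule.span (ZMod 2) (Set.range C.row) ≠ ⊤) ≤
      2 ^ Fintype.card Y / 2 ^ Fintype.card X := by
  classical
  have h1 : ∀ C : Matrix X Y (ZMod 2), Submodule.span (ZMod 2) (Set.range C.row) ≠ ⊤ →
      ∃ w : Y → ZMod 2, w ≠ 0 ∧ C.mulVec w = 0 := fun C hC => by
    obtain ⟨f, hf, hle⟩ := Submodule.exists_le_ker_of_lt_top _ (lt_top_iff_ne_top.2 hC)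
    have hfw : ∀ v : Y → ZMod 2, f v = v ⬝ᵥ fun y => f (Pi.single y 1) := fun v => by
      conv_lhs => rw [← Finset.univ_sum_single v, map_sum]
      refine Finset.sum_congr rfl fun y _ => ?_
      have : Pi.single y (v y) = v y • (Pi.single y 1 : Y → ZMod 2) := by
        rw [← Pi.single_smul, smul_eq_mul, mul_one]
      rw [this, map_smul, smul_eq_mul]
    refine ⟨fun y => f (Pi.single y 1), fun h0 => hf ?_, ?_⟩
    · ext v
      simp [congrFun h0 v]
    · ext x
      change C x ⬝ᵥ _ = 0
      rw [← hfw]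
      exact hle (Submodule.subset_span ⟨x, rfl⟩)
  have h2 : ∀ w : Y → ZMod 2, prob (fun C : Matrix X Y (ZMod 2) => w ≠ 0 ∧ C.mulVec w = 0) ≤
      1 / 2 ^ Fintype.card X := fun w => by
    by_cases hw : w = 0
    · rw [prob_eq_zero fun C h => h.1 hw]
      positivity
    obtain ⟨y, hy⟩ := Function.ne_iff.1 hw
    have hy1 : w y = 1 := by
      rw [Pi.zero_apply] at hy
      generalize w y = a at hy ⊢
      revert a; decide
    calc _ ≤ prob (fun C : Matrix X Y (ZMod 2) => C.mulVec w = 0) := prob_mono fun _ h => h.2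
      _ = prob (fun v : X → ZMod 2 => v = 0) :=
          prob_comp_surjective
            { toFun := fun C : Matrix X Y (ZMod 2) => C.mulVec w
              map_zero' := Matrix.zero_mulVec _
              map_add' := fun _ _ => Matrix.add_mulVec _ _ _ }
            (fun v => ⟨Matrix.of fun x y' => if y' = y then v x else 0, by
              ext x
              simp [Matrix.mulVec, dotProduct, hy1]⟩) fun v => v = 0
      _ = _ := by
          rw [prob_def, Finset.filter_eq' , if_pos (Finset.mem_univ _), Finset.card_singleton,
            Fintype.card_fun, ZMod.card]
          push_cast
          rfl
  calc _ ≤ prob (fun C : Matrix X Y (ZMod 2) => ∃ w : Y → ZMod 2, w ≠ 0 ∧ C.mulVec w = 0) :=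
        prob_mono h1
    _ ≤ ∑ w : Y → ZMod 2, prob (fun C : Matrix X Y (ZMod 2) => w ≠ 0 ∧ C.mulVec w = 0) :=
        prob_exists_le _
    _ ≤ ∑ w : Y → ZMod 2, (1 : ℝ) / 2 ^ Fintype.card X := Finset.sum_le_sum fun w _ => h2 w
    _ = _ := by
        rw [Finset.sum_const, Finset.card_univ, Fintype.card_fun, ZMod.card, nsmul_eq_mul]
        push_cast
        ring

theorem prob_fst {α β : Type*} [Fintype α] [Fintype β] [Nonempty β] (q : α → Prop) :
    prob (fun p : α × β => q p.1) = prob q := by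
  have hβ : (Fintype.card β : ℝ) ≠ 0 := by exact_mod_cast Fintype.card_ne_zero
  classical
  rw [prob_prod, prob_def q, Finset.card_filter]
  push_cast
  congr 1
  refine Finset.sum_congr rfl fun a _ => ?_
  by_cases h : q a <;> simp [prob_def, h, hβ]

theorem prob_submatrix {f : X → S} (hf : Function.Injective f)
    (q : Matrix X Y (ZMod 2) → Prop) :
    prob (fun C : Matrix S Y (ZMod 2) => q (C.submatrix f id)) = prob q :=
  prob_comp_injective (A := S) (β := Y → ZMod 2) f hf q

/-- `D` arises from `A` by eliminating the columns of `C` with linearly independent rows. -/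
def IsEliminated (C : Matrix X Y (ZMod 2)) (U : Matrix X T (ZMod 2)) (B : Matrix S Y (ZMod 2))
    (A D : Matrix S T (ZMod 2)) : Prop :=
  ∃ (b : Finset X) (Q : Matrix S X (ZMod 2)),
    (∀ c : X → ZMod 2, (∀ x ∉ b, c x = 0) → Matrix.vecMul c C = 0 → c = 0) ∧
    (∀ s, ∀ x ∉ b, Q s x = 0) ∧ Q * C = B ∧ A + Q * U = D

theorem prob_not_isEliminated_le (D : Matrix S T (ZMod 2)) {x : ℝ} (hx : 0 ≤ x)
    (hx2 : x ^ 2 = 1 / 2) :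
    prob (fun p : Matrix (X₁ ⊕ X₂) Y (ZMod 2) × ((Matrix (X₁ ⊕ X₂) T (ZMod 2) ×
        Matrix S Y (ZMod 2)) × Matrix S T (ZMod 2)) =>
        ¬ IsEliminated p.1 p.2.1.1 p.2.1.2 p.2.2 D) ≤
      2 ^ Fintype.card Y / 2 ^ Fintype.card X₁ + 2 ^ Fintype.card Y / 2 ^ Fintype.card X₂ +
      (2 ^ (2 * (Fintype.card S + Fintype.card T)) * ((1 + x) / 2) ^ Fintype.card Y +
        2 ^ (Fintype.card S * Fintype.card T) * ((1 + x ^ 3) / 2) ^ Fintype.card Y) := by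
  set E : ℝ := 2 ^ (2 * (Fintype.card S + Fintype.card T)) * ((1 + x) / 2) ^ Fintype.card Y +
        2 ^ (Fintype.card S * Fintype.card T) * ((1 + x ^ 3) / 2) ^ Fintype.card Y with hE
  have hE0 : 0 ≤ E := by positivity
  let q₁ : Matrix (X₁ ⊕ X₂) Y (ZMod 2) → Prop := fun C =>
    Submodule.span (ZMod 2) (Set.range (C.submatrix Sum.inl id).row) ≠ ⊤
  let q₂ : Matrix (X₁ ⊕ X₂) Y (ZMod 2) → Prop := fun C =>
    Submodule.span (ZMod 2) (Set.range (C.submatrix Sum.inr id).row) ≠ ⊤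
  let Ω := Matrix (X₁ ⊕ X₂) Y (ZMod 2) × ((Matrix (X₁ ⊕ X₂) T (ZMod 2) ×
        Matrix S Y (ZMod 2)) × Matrix S T (ZMod 2))
  have h₁ : prob (fun p : Ω => q₁ p.1) ≤ 2 ^ Fintype.card Y / 2 ^ Fintype.card X₁ := by
    rw [prob_fst]
    refine le_of_eq_of_le ?_ (prob_span_rows_ne_top_le (X := X₁) (Y := Y))
    exact prob_submatrix Sum.inl_injective fun C : Matrix X₁ Y (ZMod 2) =>
      Submodule.span (ZMod 2) (Set.range C.row) ≠ ⊤
  have h₂ : prob (fun p : Ω => q₂ p.1) ≤ 2 ^ Fintype.card Y / 2 ^ Fintype.card X₂ := by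
    rw [prob_fst]
    refine le_of_eq_of_le ?_ (prob_span_rows_ne_top_le (X := X₂) (Y := Y))
    exact prob_submatrix Sum.inr_injective fun C : Matrix X₂ Y (ZMod 2) =>
      Submodule.span (ZMod 2) (Set.range C.row) ≠ ⊤
  have h₃ : prob (fun p : Ω => ¬ q₁ p.1 ∧ ¬ q₂ p.1 ∧
      ¬ IsEliminated p.1 p.2.1.1 p.2.1.2 p.2.2 D) ≤ E := by
    -- Condition on `C`: the bases and inverses depend only on it, while `U`, `B` and `A` remain
    -- uniform and independent.
    refine prob_prod_le fun C => ?_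
    by_cases hC : ¬ q₁ C ∧ ¬ q₂ C
    · obtain ⟨b, P, hb, hP⟩ := exists_isRowInverse_family C (not_not.1 hC.1) (not_not.1 hC.2)
      refine le_trans (prob_mono ?_) (prob_forall_add_mul_mul_ne_le P hP D hx hx2)
      rintro ⟨⟨U, B⟩, A⟩ ⟨-, -, hno⟩ I heq
      refine hno ⟨b I, B * P I, (hb I).indep, fun s x hx => ?_, ?_, ?_⟩
      · rw [Matrix.mul_apply]
        exact Finset.sum_eq_zero fun y _ => by rw [(hb I).support y x hx, mul_zero]
      · rw [Matrix.mul_assoc, (hb I).mul_eq, Matrix.mul_one]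
      · rw [Matrix.mul_assoc]
        exact heq
    · rw [prob_eq_zero fun a h => hC ⟨h.1, h.2.1⟩]
      exact hE0
  calc prob (fun p : Ω => ¬ IsEliminated p.1 p.2.1.1 p.2.1.2 p.2.2 D)
      ≤ prob (fun p : Ω => (q₁ p.1 ∨ q₂ p.1) ∨ (¬ q₁ p.1 ∧ ¬ q₂ p.1 ∧
          ¬ IsEliminated p.1 p.2.1.1 p.2.1.2 p.2.2 D)) := prob_mono fun p hp => by tauto
    _ ≤ prob (fun p : Ω => q₁ p.1) + prob (fun p : Ω => q₂ p.1) + E :=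
        (prob_or_le _ _).trans (add_le_add (prob_or_le _ _) h₃)
    _ ≤ _ := by gcongr

end Core

/-! ### The failure probability for a single target -/

namespace OrderedBipartiteGraph

variable {V : Type*} [Fintype V] [DecidableEq V]

theorem ofMatrix_isPivotMinor_of_isEliminated {X Y : Type*} [Fintype X] [Fintype Y]
    [DecidableEq X] [DecidableEq Y] {L R HL HR : Finset V} (h : Disjoint L R)
    (hH : Disjoint HL HR) (hL : HL ⊆ L) (hR : HR ⊆ R) (M D : V → V → ZMod 2) (e : X → V)
    (he : Function.Injective e) (heL : ∀ x, e x ∈ L \ HL) (f : Y → V) (hfR : ∀ y, f y ∈ R \ HR)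
    (hM : IsEliminated (Matrix.of fun x y => M (e x) (f y))
      (Matrix.of fun x (t : HR) => M (e x) t) (Matrix.of fun (s : HL) y => M s (f y))
      (Matrix.of fun (s : HL) (t : HR) => M s t) (Matrix.of fun (s : HL) (t : HR) => D s t)) :
    (ofMatrix HL HR hH D).IsPivotMinor (ofMatrix L R h M) := by
  obtain ⟨b, Q, hind, hsupp, hQ, hD⟩ := hM
  let Q' : V → V → ZMod 2 := fun s x =>
    if hs : s ∈ HL then Function.extend e (Q ⟨s, hs⟩) 0 x else 0
  have hQ' : ∀ s (hs : s ∈ HL) x, Q' s (e x) = Q ⟨s, hs⟩ x := fun s hs x => by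
    simp only [Q', dif_pos hs]
    exact he.extend_apply _ _ _
  have hsum : ∀ s (hs : s ∈ HL) z, ∑ x ∈ b.image e, Q' s x * M x z =
      ∑ x, Q ⟨s, hs⟩ x * M (e x) z := fun s hs z => by
    rw [Finset.sum_image he.injOn]
    simp only [hQ' s hs]
    refine Finset.sum_subset (Finset.subset_univ _) fun x _ hx => ?_
    rw [hsupp _ x hx, zero_mul]
  have key := ofMatrix_eliminate_isPivotMinor (b.image e) (Finset.univ.image f) h hH M Q'
    (Finset.image_subset_iff.2 fun x _ => (Finset.mem_sdiff.1 (heL x)).1)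
    (Finset.image_subset_iff.2 fun y _ => (Finset.mem_sdiff.1 (hfR y)).1) ?_ ?_ ?_ ?_
  · rwa [ofMatrix_congr rfl rfl fun s hs t ht => ?_] at key
    have := congrFun (congrFun hD ⟨s, hs⟩) ⟨t, ht⟩
    rw [hsum s hs]
    exact this
  · intro s hs
    refine Finset.mem_sdiff.2 ⟨hL hs, fun hmem => ?_⟩
    obtain ⟨x, _, rfl⟩ := Finset.mem_image.1 hmem
    exact (Finset.mem_sdiff.1 (heL x)).2 hs
  · intro t ht
    refine Finset.mem_sdiff.2 ⟨hR ht, fun hmem => ?_⟩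
    obtain ⟨x, _, rfl⟩ := Finset.mem_image.1 hmem
    exact (Finset.mem_sdiff.1 (hfR x)).2 ht
  · intro c hc x hx
    obtain ⟨x, hxb, rfl⟩ := Finset.mem_image.1 hx
    have h0 := hind (fun x => if x ∈ b then c (e x) else 0) (fun x hx => if_neg hx) ?_
    · simpa [hxb] using congrFun h0 x
    · ext y
      have := hc (f y) (Finset.mem_image_of_mem _ (Finset.mem_univ y))
      rw [Finset.sum_image he.injOn] at this
      simp only [Matrix.vecMul, dotProduct, Matrix.of_apply, ite_mul, zero_mul]
      rw [← Finset.sum_filter, Finset.filter_mem_eq_inter, Finset.univ_inter]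
      exact this
  · intro s hs y hy
    obtain ⟨y, _, rfl⟩ := Finset.mem_image.1 hy
    rw [hsum s hs]
    exact (congrFun (congrFun hQ ⟨s, hs⟩) y).symm

/-- Reading off the four disjoint blocks is a surjective homomorphism, so they are jointly uniform,
hence independent. -/
theorem prob_blocks {S T X Y : Type*} [Fintype S] [Fintype T] [Fintype X] [Fintype Y]
    [DecidableEq S] [DecidableEq T] [DecidableEq X] [DecidableEq Y] (ρ : S ⊕ X → V) (γ : T ⊕ Y → V)
    (hρ : Function.Injective ρ) (hγ : Function.Injective γ)
    (q : Matrix X Y (ZMod 2) → Matrix X T (ZMod 2) → Matrix S Y (ZMod 2) →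
      Matrix S T (ZMod 2) → Prop) :
    prob (fun M : V → V → ZMod 2 =>
      q (Matrix.of fun x y => M (ρ (Sum.inr x)) (γ (Sum.inr y)))
        (Matrix.of fun x t => M (ρ (Sum.inr x)) (γ (Sum.inl t)))
        (Matrix.of fun s y => M (ρ (Sum.inl s)) (γ (Sum.inr y)))
        (Matrix.of fun s t => M (ρ (Sum.inl s)) (γ (Sum.inl t)))) =
    prob (fun p : Matrix X Y (ZMod 2) × ((Matrix X T (ZMod 2) × Matrix S Y (ZMod 2)) ×
      Matrix S T (ZMod 2)) => q p.1 p.2.1.1 p.2.1.2 p.2.2) := by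
  let φ : (V → V → ZMod 2) →+ Matrix X Y (ZMod 2) × ((Matrix X T (ZMod 2) ×
      Matrix S Y (ZMod 2)) × Matrix S T (ZMod 2)) :=
    { toFun := fun M => (Matrix.of fun x y => M (ρ (Sum.inr x)) (γ (Sum.inr y)),
        ((Matrix.of fun x t => M (ρ (Sum.inr x)) (γ (Sum.inl t)),
          Matrix.of fun s y => M (ρ (Sum.inl s)) (γ (Sum.inr y))),
          Matrix.of fun s t => M (ρ (Sum.inl s)) (γ (Sum.inl t))))
      map_zero' := rfl
      map_add' := fun _ _ => rfl }
  refine prob_comp_surjective φ ?_ fun p => q p.1 p.2.1.1 p.2.1.2 p.2.2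
  rintro ⟨C, ⟨U, B⟩, A⟩
  have hext : ∀ N : S ⊕ X → T ⊕ Y → ZMod 2,
      ∃ M : V → V → ZMod 2, ∀ i j, M (ρ i) (γ j) = N i j := fun N =>
    ⟨Function.extend ρ (fun i => Function.extend γ (N i) 0) 0, fun i j => by
      rw [hρ.extend_apply, hγ.extend_apply]⟩
  obtain ⟨M, hM⟩ := hext (Matrix.fromBlocks A B U C)
  refine ⟨M, ?_⟩
  refine Prod.ext ?_ (Prod.ext (Prod.ext ?_ ?_) ?_)
  · ext i j; exact hM (Sum.inr i) (Sum.inr j)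
  · ext i j; exact hM (Sum.inr i) (Sum.inl j)
  · ext i j; exact hM (Sum.inl i) (Sum.inr j)
  · ext i j; exact hM (Sum.inl i) (Sum.inl j)

/-- The failure probability when all the vertices of the target are on the correct sides. -/
theorem prob_not_isPivotMinor_le_of_subset {L R HL HR : Finset V} (h : Disjoint L R)
    (hH : Disjoint HL HR) (hL : HL ⊆ L) (hR : HR ⊆ R) (D : V → V → ZMod 2) {m n : ℕ}
    (hn : 2 * n + HL.card ≤ L.card) (hm : m + HR.card ≤ R.card) {x : ℝ} (hx : 0 ≤ x)
    (hx2 : x ^ 2 = 1 / 2) :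
    prob (fun M : V → V → ZMod 2 => ¬ (ofMatrix HL HR hH D).IsPivotMinor (ofMatrix L R h M)) ≤
      2 * (2 ^ m / 2 ^ n) + (2 ^ (2 * (HL.card + HR.card)) * ((1 + x) / 2) ^ m +
        2 ^ (HL.card * HR.card) * ((1 + x ^ 3) / 2) ^ m) := by
  obtain ⟨e⟩ : Nonempty ((Fin n ⊕ Fin n) ↪ ↥(L \ HL)) := by
    refine Function.Embedding.nonempty_of_card_le ?_
    rw [Fintype.card_coe, Finset.card_sdiff_of_subset hL]
    simp
    omega
  obtain ⟨f⟩ : Nonempty (Fin m ↪ ↥(R \ HR)) := by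
    refine Function.Embedding.nonempty_of_card_le ?_
    rw [Fintype.card_coe, Finset.card_sdiff_of_subset hR]
    simp
    omega
  let ρ : HL ⊕ (Fin n ⊕ Fin n) → V := Sum.elim Subtype.val fun x => (e x : V)
  let γ : HR ⊕ Fin m → V := Sum.elim Subtype.val fun y => (f y : V)
  have he : Function.Injective fun x => (e x : V) := Subtype.val_injective.comp e.injective
  have hρ : Function.Injective ρ := Function.Injective.sumElim Subtype.val_injective he
    fun s x hsx => (Finset.mem_sdiff.1 (e x).2).2 (hsx ▸ s.2)
  have hγ : Function.Injective γ := Function.Injective.sumElim Subtype.val_injective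
    (Subtype.val_injective.comp f.injective)
    fun t y hty => (Finset.mem_sdiff.1 (f y).2).2 (hty ▸ t.2)
  have hblocks := prob_blocks ρ γ hρ hγ fun C U B A =>
    ¬ IsEliminated C U B A (Matrix.of fun (s : HL) (t : HR) => D s t)
  have key := prob_not_isEliminated_le (X₁ := Fin n) (X₂ := Fin n) (Y := Fin m)
    (Matrix.of fun (s : HL) (t : HR) => D s t) hx hx2
  have hmono : prob (fun M : V → V → ZMod 2 =>
      ¬ (ofMatrix HL HR hH D).IsPivotMinor (ofMatrix L R h M)) ≤ _ :=
    (prob_mono fun M hM helim => hM (ofMatrix_isPivotMinor_of_isEliminated h hH hL hR M D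
      (fun x => (e x : V)) he (fun x => (e x).2) (fun y => (f y : V)) (fun y => (f y).2) helim)).trans
      hblocks.le
  refine (hmono.trans key).trans_eq ?_
  rw [Fintype.card_fin, Fintype.card_fin, Fintype.card_coe, Fintype.card_coe, ← two_mul]

theorem prob_forall_mem_eq_zero (P : Finset V) :
    prob (fun ρ : V → ZMod 2 => ∀ y ∈ P, ρ y = 0) = (1 / 2) ^ P.card := by
  have h1 := prob_comp_injective (A := V) (β := ZMod 2) (Subtype.val : P → V)
    Subtype.val_injective fun σ => σ = 0
  have h2 : (fun M : V → ZMod 2 => M ∘ (Subtype.val : P → V) = 0) =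
      fun ρ => ∀ y ∈ P, ρ y = 0 := by
    ext ρ
    simp [funext_iff]
  rw [h2] at h1
  rw [h1, prob_def, Finset.filter_eq', if_pos (Finset.mem_univ _), Finset.card_singleton,
    Fintype.card_fun, ZMod.card, Fintype.card_coe]
  simp

/-- Moving a vertex `s` to the right side by pivoting with a neighbour in the set `P`. -/
theorem prob_not_isPivotMinor_le_of_switch {L R HL HR : Finset V} (h : Disjoint L R)
    (hH : Disjoint HL HR) (D : V → V → ZMod 2) {s : V} (hs : s ∈ L) (P : Finset V) (hP : P ⊆ R)
    {ε : ℝ} (hε0 : 0 ≤ ε)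
    (hε : ∀ y ∈ P, ∀ h' : Disjoint (L.erase s) (insert s (R.erase y)),
      prob (fun M : V → V → ZMod 2 => ¬ (ofMatrix HL HR hH D).IsPivotMinor
        (ofMatrix (L.erase s) (insert s (R.erase y)) h' M)) ≤ ε) :
    prob (fun M : V → V → ZMod 2 => ¬ (ofMatrix HL HR hH D).IsPivotMinor (ofMatrix L R h M)) ≤
      (1 / 2) ^ P.card + ε := by
  set bad : (V → V → ZMod 2) → Prop := fun M =>
    ¬ (ofMatrix HL HR hH D).IsPivotMinor (ofMatrix L R h M) with hbad
  -- Row `s` is drawn separately so that a neighbour `y` can be chosen from it without conditioning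
  -- the other rows.
  have hupd : prob bad = prob fun p : (V → ZMod 2) × (V → V → ZMod 2) =>
      bad (Function.update p.2 s p.1) := by
    symm
    refine prob_comp_surjective
      { toFun := fun p : (V → ZMod 2) × (V → V → ZMod 2) => Function.update p.2 s p.1
        map_zero' := Function.update_eq_self s (0 : V → V → ZMod 2)
        map_add' := fun p q => Function.update_add p.2 q.2 s p.1 q.1 }
      (fun M => ⟨(M s, M), Function.update_eq_self s M⟩) bad
  rw [hupd]
  calc _ ≤ prob (fun p : (V → ZMod 2) × (V → V → ZMod 2) => (∀ y ∈ P, p.1 y = 0) ∨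
          ((¬ ∀ y ∈ P, p.1 y = 0) ∧ bad (Function.update p.2 s p.1))) :=
        prob_mono fun p hp => by tauto
    _ ≤ _ := prob_or_le _ _
    _ ≤ (1 / 2) ^ P.card + ε := by
        refine add_le_add ?_ (prob_prod_le fun ρ => ?_)
        · rw [prob_fst fun ρ : V → ZMod 2 => ∀ y ∈ P, ρ y = 0, prob_forall_mem_eq_zero]
        by_cases hρ : ∀ y ∈ P, ρ y = 0
        · rw [prob_eq_zero fun M hM => hM.1 hρ]
          exact hε0
        push Not at hρ
        obtain ⟨y, hy, hρy⟩ := hρ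
        have hρ1 : ρ y = 1 := by
          generalize ρ y = a at hρy ⊢
          revert a; decide
        have hyR := hP hy
        have hd : Disjoint (L.erase s) (insert s (R.erase y)) := by
          rw [Finset.disjoint_left] at h ⊢
          intro x
          have := @h x
          simp only [Finset.mem_erase, Finset.mem_insert]
          tauto
        have hsR := Finset.disjoint_left.1 h hs
        have hsy : y ≠ s := by rintro rfl; exact hsR hyR
        -- For a fixed row `ρ` of `s`, the pivoted matrix is a linear function of the other rows.
        -- The deleted column `y` stores the old column `s`, which makes the map surjective, so
        -- uniformity is preserved.
        let T : (V → V → ZMod 2) →+ (V → V → ZMod 2) :=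
          { toFun := fun M x z => if z = s then M x y else if z = y then M x s else
              M x z + M x y * ρ z
            map_zero' := by ext; simp
            map_add' := fun M N => by
              ext x z
              simp only [Pi.add_apply]
              split_ifs <;> ring }
        have hT : Function.Surjective T := fun N => by
          refine ⟨fun x z => if z = y then N x s else if z = s then N x y else
            N x z - N x s * ρ z, ?_⟩
          ext x z
          simp only [T, AddMonoidHom.coe_mk, ZeroHom.coe_mk]
          by_cases hzs : z = s
          · subst hzs; simp
          by_cases hzy : z = y
          · subst hzy; simp [hzs, Ne.symm hzs]
          · simp [hzs, hzy]
        refine le_trans ?_ (hε y hy hd)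
        rw [← prob_comp_surjective T hT fun M =>
          ¬ (ofMatrix HL HR hH D).IsPivotMinor (ofMatrix (L.erase s) (insert s (R.erase y)) hd M)]
        refine prob_mono fun M hM hminor => hM.2 ?_
        have hup : Function.update M s ρ s y = 1 := by
          rw [Function.update_self, hρ1]
        refine IsPivotMinor.trans ?_ (ofMatrix_pivot_isPivotMinor h _ hs hyR hup hd)
        convert hminor using 1
        refine ofMatrix_congr rfl rfl fun x hx z hz => ?_
        have hxs : x ≠ s := (Finset.mem_erase.1 hx).1
        simp only [T, AddMonoidHom.coe_mk, ZeroHom.coe_mk, Function.update_self,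
          Function.update_of_ne hxs]
        by_cases hzs : z = s
        · rw [if_pos hzs, if_pos hzs]
        · have hzy : z ≠ y := by
            rintro rfl
            simp [hzs] at hz
          rw [if_neg hzs, if_neg hzs, if_neg hzy]

theorem prob_not_isPivotMinor_swap {L R HL HR : Finset V} (h : Disjoint L R)
    (hH : Disjoint HL HR) (D : V → V → ZMod 2) :
    prob (fun M : V → V → ZMod 2 => ¬ (ofMatrix HL HR hH D).IsPivotMinor (ofMatrix L R h M)) ≤
    prob (fun M : V → V → ZMod 2 => ¬ (ofMatrix HR HL hH.symm fun x y => D y x).IsPivotMinor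
      (ofMatrix R L h.symm M)) := by
  rw [← prob_equiv (Equiv.piComm fun _ _ => ZMod 2)]
  refine prob_mono fun M hM hminor => hM ?_
  have := isPivotMinor_swap hminor
  rw [ofMatrix_swap, ofMatrix_swap] at this
  exact this

/-- The failure probability for an arbitrary target, with `d` vertices on the wrong side. -/
theorem prob_not_isPivotMinor_le {k w m n K : ℕ} (hn : 2 * n + k ≤ K) (hm : m + k ≤ K)
    {x : ℝ} (hx : 0 ≤ x) (hx2 : x ^ 2 = 1 / 2) (d : ℕ) :
    ∀ {L R HL HR : Finset V} (h : Disjoint L R) (hH : Disjoint HL HR) (D : V → V → ZMod 2),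
    HL ∪ HR ⊆ L ∪ R → HL.card + HR.card = k → HL.card * HR.card ≤ w →
    (HR ∩ L).card + (HL ∩ R).card = d → K + d ≤ L.card → K + d ≤ R.card →
    prob (fun M : V → V → ZMod 2 => ¬ (ofMatrix HL HR hH D).IsPivotMinor (ofMatrix L R h M)) ≤
      d * (1 / 2) ^ (K - k) + (2 * (2 ^ m / 2 ^ n) + (2 ^ (2 * k) * ((1 + x) / 2) ^ m +
        2 ^ w * ((1 + x ^ 3) / 2) ^ m)) := by
  induction d with
  | zero =>
    intro L R HL HR h hH D hsub hk hw hd hKL hKR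
    simp only [Nat.add_eq_zero_iff, Finset.card_eq_zero] at hd
    have hL : HL ⊆ L := fun v hv => by
      rcases Finset.mem_union.1 (hsub (Finset.mem_union_left _ hv)) with h1 | h1
      · exact h1
      · exact absurd (Finset.mem_inter.2 ⟨hv, h1⟩) (by simp [hd.2])
    have hR : HR ⊆ R := fun v hv => by
      rcases Finset.mem_union.1 (hsub (Finset.mem_union_right _ hv)) with h1 | h1
      · exact absurd (Finset.mem_inter.2 ⟨hv, h1⟩) (by simp [hd.1])
      · exact h1
    refine (prob_not_isPivotMinor_le_of_subset h hH hL hR D (m := m) (n := n) (by omega)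
      (by omega) hx hx2).trans ?_
    rw [hk, Nat.cast_zero, zero_mul, zero_add]
    gcongr
    norm_num
  | succ d ih =>
    set E : ℝ := 2 * (2 ^ m / 2 ^ n) + (2 ^ (2 * k) * ((1 + x) / 2) ^ m +
        2 ^ w * ((1 + x ^ 3) / 2) ^ m) with hE
    have hE0 : 0 ≤ E := by positivity
    have step : ∀ {L R HL HR : Finset V} (h : Disjoint L R) (hH : Disjoint HL HR)
        (D : V → V → ZMod 2), HL ∪ HR ⊆ L ∪ R → HL.card + HR.card = k → HL.card * HR.card ≤ w →
        (HR ∩ L).card + (HL ∩ R).card = d + 1 → K + (d + 1) ≤ L.card → K + (d + 1) ≤ R.card →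
        (HR ∩ L).Nonempty →
        prob (fun M : V → V → ZMod 2 =>
          ¬ (ofMatrix HL HR hH D).IsPivotMinor (ofMatrix L R h M)) ≤
          (d + 1 : ℕ) * (1 / 2) ^ (K - k) + E := by
      intro L R HL HR h hH D hsub hk hw hd hKL hKR ⟨s, hs⟩
      obtain ⟨hsHR, hsL⟩ := Finset.mem_inter.1 hs
      have hsR := Finset.disjoint_left.1 h hsL
      have hsHL : s ∉ HL := fun h1 => Finset.disjoint_left.1 hH h1 hsHR
      have hPcard : K - k ≤ (R \ (HL ∪ HR)).card := by
        have h1 := Finset.le_card_sdiff (HL ∪ HR) R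
        have h2 := Finset.card_union_le HL HR
        omega
      -- Partners are taken outside the target, so no target vertex is deleted. The switch shrinks
      -- `L` by one and keeps the size of `R`, whence the margin `d` in the size hypotheses.
      refine (prob_not_isPivotMinor_le_of_switch h hH D hsL (R \ (HL ∪ HR)) Finset.sdiff_subset
        (ε := d * (1 / 2) ^ (K - k) + E) (by positivity) fun y hy hd' => ?_).trans ?_
      · simp only [Finset.mem_sdiff, Finset.mem_union, not_or] at hy
        obtain ⟨hyR, hyHL, hyHR⟩ := hy
        refine ih hd' hH D ?_ hk hw ?_ ?_ ?_
        · intro v hv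
          have h1 := hsub hv
          simp only [Finset.mem_union, Finset.mem_erase, Finset.mem_insert] at hv h1 ⊢
          by_cases hvs : v = s
          · tauto
          · have : v ≠ y := by rintro rfl; tauto
            tauto
        · have h1 : HR ∩ L.erase s = (HR ∩ L).erase s := Finset.inter_erase _ _ _
          have h2 : HL ∩ insert s (R.erase y) = HL ∩ R := by
            ext v
            simp only [Finset.mem_inter, Finset.mem_insert, Finset.mem_erase]
            constructor
            · rintro ⟨hv, rfl | hv'⟩
              · exact absurd hv hsHL
              · exact ⟨hv, hv'.2⟩
            · rintro ⟨hv, hv'⟩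
              exact ⟨hv, Or.inr ⟨by rintro rfl; exact hyHL hv, hv'⟩⟩
          rw [h1, h2, Finset.card_erase_of_mem hs]
          have : 0 < (HR ∩ L).card := Finset.card_pos.2 ⟨s, hs⟩
          omega
        · rw [Finset.card_erase_of_mem hsL]
          omega
        · have hs' : s ∉ R.erase y := fun h1 => hsR (Finset.mem_of_mem_erase h1)
          rw [Finset.card_insert_of_notMem hs', Finset.card_erase_of_mem hyR]
          have : 0 < R.card := Finset.card_pos.2 ⟨y, hyR⟩
          omega
      · have : ((1 : ℝ) / 2) ^ (R \ (HL ∪ HR)).card ≤ (1 / 2) ^ (K - k) :=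
          pow_le_pow_of_le_one (by norm_num) (by norm_num) hPcard
        push_cast
        linarith
    intro L R HL HR h hH D hsub hk hw hd hKL hKR
    by_cases hne : (HR ∩ L).Nonempty
    · exact step h hH D hsub hk hw hd hKL hKR hne
    · have hne' : (HL ∩ R).Nonempty := by
        rw [Finset.not_nonempty_iff_eq_empty] at hne
        rw [hne, Finset.card_empty, zero_add] at hd
        exact Finset.card_pos.1 (by omega)
      refine (prob_not_isPivotMinor_swap h hH D).trans ?_
      exact step h.symm hH.symm _ (by rwa [Finset.union_comm, Finset.union_comm R])
        (by omega) (by rwa [mul_comm]) (by omega) hKR hKL hne'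

end OrderedBipartiteGraph

/-! ### From matrices to the random graph, and the union bound -/

namespace OrderedBipartiteGraph

theorem prob_eq_toReal_uniformOfFintype {α : Type*} [Fintype α] [Nonempty α] (s : Set α) :
    ((PMF.uniformOfFintype α).toOuterMeasure s).toReal = prob fun a => a ∈ s := by
  classical
  rw [PMF.toOuterMeasure_uniformOfFintype_apply, prob_def, ENNReal.toReal_div,
    ENNReal.toReal_natCast, ENNReal.toReal_natCast, Fintype.card_subtype]

theorem prob_not {α : Type*} [Fintype α] [Nonempty α] (p : α → Prop) :
    prob (fun a => ¬ p a) = 1 - prob p := by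
  classical
  have hα : (Fintype.card α : ℝ) ≠ 0 := by exact_mod_cast Fintype.card_ne_zero
  rw [eq_sub_iff_add_eq, prob_def, prob_def, ← add_div, div_eq_one_iff_eq hα, add_comm]
  exact_mod_cast Finset.card_filter_add_card_filter_not (s := Finset.univ) p

theorem disjoint_image_inl_inr (ℓ r : ℕ) :
    Disjoint (Finset.univ.image Sum.inl : Finset (Fin ℓ ⊕ Fin r))
      (Finset.univ.image Sum.inr) := by
  rw [Finset.disjoint_left]
  simp

/-- The edge set encoded by a matrix. -/
def edgeEquiv (J : Type*) [Fintype J] [DecidableEq J] : (J → ZMod 2) ≃ Finset J where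
  toFun f := Finset.univ.filter fun j => f j = 1
  invFun E j := if j ∈ E then 1 else 0
  left_inv f := by
    ext j
    simp only [Finset.mem_filter, Finset.mem_univ, true_and]
    generalize f j = a
    revert a; decide
  right_inv E := by
    ext j
    simp

theorem ofEdges_edgeEquiv {ℓ r : ℕ} (M : Fin ℓ ⊕ Fin r → Fin ℓ ⊕ Fin r → ZMod 2) :
    ofEdges (edgeEquiv (Fin ℓ × Fin r) fun p => M (Sum.inl p.1) (Sum.inr p.2)) =
      ofMatrix (Finset.univ.image Sum.inl) (Finset.univ.image Sum.inr)
        (disjoint_image_inl_inr ℓ r) M := by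
  ext x y
  · simp [ofEdges, ofMatrix]
  · simp [ofEdges, ofMatrix]
  · simp only [ofEdges, ofMatrix, SimpleGraph.fromRel_adj, edgeEquiv, Equiv.coe_fn_mk,
      Finset.mem_filter, Finset.mem_univ, true_and, Finset.mem_image]
    constructor
    · rintro ⟨-, ⟨a, b, h, rfl, rfl⟩ | ⟨a, b, h, rfl, rfl⟩⟩
      · exact Or.inl ⟨⟨a, rfl⟩, ⟨b, rfl⟩, h⟩
      · exact Or.inr ⟨⟨a, rfl⟩, ⟨b, rfl⟩, h⟩
    · rintro (⟨⟨a, rfl⟩, ⟨b, rfl⟩, h⟩ | ⟨⟨a, rfl⟩, ⟨b, rfl⟩, h⟩)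
      · exact ⟨by simp, Or.inl ⟨a, b, h, rfl, rfl⟩⟩
      · exact ⟨by simp, Or.inr ⟨a, b, h, rfl, rfl⟩⟩

theorem one_sub_probUniversal_eq (ℓ r k : ℕ) : 1 - probUniversal ℓ r k =
    prob fun M : Fin ℓ ⊕ Fin r → Fin ℓ ⊕ Fin r → ZMod 2 =>
      ¬ IsPivotMinorUniversal k (ofMatrix (Finset.univ.image Sum.inl) (Finset.univ.image Sum.inr)
        (disjoint_image_inl_inr ℓ r) M) := by
  unfold probUniversal random
  rw [PMF.toOuterMeasure_map_apply, prob_eq_toReal_uniformOfFintype, ← prob_not]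
  rw [← prob_equiv (edgeEquiv (Fin ℓ × Fin r))]
  have hinj : Function.Injective fun p : Fin ℓ × Fin r =>
      ((Sum.inl p.1, Sum.inr p.2) : (Fin ℓ ⊕ Fin r) × (Fin ℓ ⊕ Fin r)) := by
    rintro ⟨a, b⟩ ⟨a', b'⟩ h
    simpa using h
  rw [← prob_comp_injective _ hinj fun f : Fin ℓ × Fin r → ZMod 2 =>
    ¬ (edgeEquiv (Fin ℓ × Fin r) f ∈ ofEdges ⁻¹' {G | IsPivotMinorUniversal k G})]
  rw [← prob_equiv (Equiv.curry (Fin ℓ ⊕ Fin r) (Fin ℓ ⊕ Fin r) (ZMod 2))]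
  congr 1
  ext M
  rw [← ofEdges_edgeEquiv]
  rfl

variable {V : Type*} [Fintype V] [DecidableEq V]

open scoped Classical in
theorem exists_eq_ofMatrix (H : OrderedBipartiteGraph V) :
    ∃ (HL HR : Finset V) (hH : Disjoint HL HR) (D : V → V → ZMod 2),
      H = ofMatrix HL HR hH D := by
  have hd : Disjoint H.L.toFinset H.R.toFinset := Set.disjoint_toFinset.2 H.isBipartiteWith.1
  refine ⟨H.L.toFinset, H.R.toFinset, hd, fun x y => if H.graph.Adj x y then 1 else 0, ?_⟩
  ext x y
  · simp [ofMatrix]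
  · simp [ofMatrix]
  · have h1 := @H.isBipartiteWith.mem_of_adj x y
    have h2 := H.graph.adj_comm x y
    simp only [ofMatrix, Set.mem_toFinset]
    by_cases h : H.graph.Adj x y
    · have := h1 h
      have := h2.1 h
      simp only [h, this, if_true]
      tauto
    · have h3 : ¬ H.graph.Adj y x := fun h' => h (h2.2 h')
      simp [h, h3]

theorem exists_labelling {k : ℕ} {HL HR : Finset V} (hH : Disjoint HL HR)
    (hk : HL.card + HR.card = k) : ∃ g : Fin k → V × Bool,
      HL = (Finset.univ.filter fun v => ∃ i, g i = (v, true)) ∧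
      HR = (Finset.univ.filter fun v => ∃ i, g i = (v, false)) := by
  have hcard : (HL ∪ HR).card = k := by rw [Finset.card_union_of_disjoint hH, hk]
  let e : Fin k ≃ ↥(HL ∪ HR) := ((HL ∪ HR).equivFinOfCardEq hcard).symm
  refine ⟨fun i => (e i, decide ((e i : V) ∈ HL)), ?_, ?_⟩
  · ext v
    simp only [Finset.mem_filter, Finset.mem_univ, true_and, Prod.mk.injEq, decide_eq_true_eq]
    constructor
    · intro hv
      exact ⟨e.symm ⟨v, Finset.mem_union_left _ hv⟩, by simp, by simpa using hv⟩
    · rintro ⟨i, rfl, h⟩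
      exact h
  · ext v
    simp only [Finset.mem_filter, Finset.mem_univ, true_and, Prod.mk.injEq, decide_eq_false_iff_not]
    constructor
    · intro hv
      exact ⟨e.symm ⟨v, Finset.mem_union_right _ hv⟩, by simp,
        by simpa using Finset.disjoint_right.1 hH hv⟩
    · rintro ⟨i, rfl, h⟩
      have := (e i).2
      rw [Finset.mem_union] at this
      tauto

/-- The union bound over all the targets. -/
theorem prob_not_isPivotMinorUniversal_le {k : ℕ} {L R : Finset V} (h : Disjoint L R) {ε : ℝ}
    (hε0 : 0 ≤ ε)
    (hε : ∀ (HL HR : Finset V) (hH : Disjoint HL HR) (D : V → V → ZMod 2), HL ∪ HR ⊆ L ∪ R →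
      HL.card + HR.card = k → prob (fun M : V → V → ZMod 2 =>
        ¬ (ofMatrix HL HR hH D).IsPivotMinor (ofMatrix L R h M)) ≤ ε) :
    prob (fun M : V → V → ZMod 2 => ¬ IsPivotMinorUniversal k (ofMatrix L R h M)) ≤
      (2 * Fintype.card V) ^ k * (2 ^ (k ^ 2 / 4) * ε) := by
  -- A labelled list of vertices with sides encodes the vertex sets of a target; overcounting is
  -- harmless. The edges then contribute at most 2^(k²/4) choices.
  let hl : (Fin k → V × Bool) → Finset V := fun g =>
    Finset.univ.filter fun v => ∃ i, g i = (v, true)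
  let hr : (Fin k → V × Bool) → Finset V := fun g =>
    Finset.univ.filter fun v => ∃ i, g i = (v, false)
  let ext : ∀ g, (hl g → hr g → ZMod 2) → V → V → ZMod 2 := fun g D x y =>
    if hx : x ∈ hl g then if hy : y ∈ hr g then D ⟨x, hx⟩ ⟨y, hy⟩ else 0 else 0
  let good : (Fin k → V × Bool) → Prop := fun g =>
    Disjoint (hl g) (hr g) ∧ hl g ∪ hr g ⊆ L ∪ R ∧ (hl g).card + (hr g).card = k
  let bad : (Fin k → V × Bool) → (V → V → ZMod 2) → (V → V → ZMod 2) → Prop := fun g D M =>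
    ∃ hg : good g, ¬ (ofMatrix (hl g) (hr g) hg.1 D).IsPivotMinor (ofMatrix L R h M)
  have hbad : ∀ g D, prob (bad g D) ≤ ε := fun g D => by
    by_cases hg : good g
    · refine le_trans (prob_mono ?_) (hε (hl g) (hr g) hg.1 D hg.2.1 hg.2.2)
      rintro M ⟨_, hM⟩
      exact hM
    · rw [prob_eq_zero fun M hM => hg hM.1]
      exact hε0
  have hg : ∀ g, prob (fun M => ∃ D, bad g (ext g D) M) ≤ 2 ^ (k ^ 2 / 4) * ε := fun g => by
    by_cases hg : good g
    · refine (prob_exists_le _).trans ((Finset.sum_le_sum fun D _ => hbad g (ext g D)).trans ?_)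
      rw [Finset.sum_const, Finset.card_univ, nsmul_eq_mul, Fintype.card_fun, Fintype.card_fun,
        ZMod.card, Fintype.card_coe, Fintype.card_coe, ← pow_mul]
      push_cast
      gcongr
      · norm_num
      · rw [Nat.le_div_iff_mul_le (by norm_num), ← hg.2.2]
        zify
        nlinarith [sq_nonneg (((hl g).card : ℤ) - (hr g).card)]
    · rw [prob_eq_zero]
      · positivity
      · rintro M ⟨D, hD⟩
        exact hg hD.1
  calc _ ≤ prob (fun M => ∃ g, ∃ D, bad g (ext g D) M) := prob_mono fun M hM => by
        simp only [IsPivotMinorUniversal, not_forall] at hM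
        obtain ⟨H, hsub, hcard, hno⟩ := hM
        obtain ⟨HL, HR, hH, D, rfl⟩ := exists_eq_ofMatrix H
        have hsub' : HL ∪ HR ⊆ L ∪ R := by
          intro v hv
          have := @hsub v
          simpa [verts, ofMatrix] using this (by simpa [verts, ofMatrix] using hv)
        have hcard' : HL.card + HR.card = k := by
          simp only [verts, ofMatrix, ← Finset.coe_union] at hcard
          rw [Set.encard_coe_eq_coe_finsetCard, Finset.card_union_of_disjoint hH] at hcard
          exact_mod_cast hcard
        obtain ⟨g, hgL, hgR⟩ := exists_labelling hH hcard'
        change HL = hl g at hgL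
        change HR = hr g at hgR
        subst hgL hgR
        refine ⟨g, fun x y => D x y, ⟨hH, hsub', hcard'⟩, fun hmin => hno ?_⟩
        convert hmin using 1
        refine ofMatrix_congr rfl rfl fun x hx y hy => ?_
        simp only [ext, dif_pos hx, dif_pos hy]
    _ ≤ ∑ g : Fin k → V × Bool, prob (fun M => ∃ D, bad g (ext g D) M) := prob_exists_le _
    _ ≤ ∑ g : Fin k → V × Bool, 2 ^ (k ^ 2 / 4) * ε := Finset.sum_le_sum fun g _ => hg g
    _ = _ := by
        rw [Finset.sum_const, Finset.card_univ, Fintype.card_fun, Fintype.card_prod,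
          Fintype.card_bool, Fintype.card_fin, nsmul_eq_mul]
        push_cast
        ring

theorem one_sub_probUniversal_le {ℓ r k m n : ℕ} (hrℓ : r ≤ ℓ) (hn : 2 * n + 2 * k ≤ r)
    (hm : m + 2 * k ≤ r) {x : ℝ} (hx : 0 ≤ x) (hx2 : x ^ 2 = 1 / 2) :
    1 - probUniversal ℓ r k ≤ (2 * (ℓ + r : ℝ)) ^ k * (2 ^ (k ^ 2 / 4) *
      (k * (1 / 2) ^ (r - 2 * k) + (2 * (2 ^ m / 2 ^ n) + (2 ^ (2 * k) * ((1 + x) / 2) ^ m +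
        2 ^ (k ^ 2 / 4) * ((1 + x ^ 3) / 2) ^ m)))) := by
  rw [one_sub_probUniversal_eq]
  refine (prob_not_isPivotMinorUniversal_le (disjoint_image_inl_inr ℓ r)
    (ε := k * (1 / 2) ^ (r - 2 * k) + (2 * (2 ^ m / 2 ^ n) + (2 ^ (2 * k) * ((1 + x) / 2) ^ m +
        2 ^ (k ^ 2 / 4) * ((1 + x ^ 3) / 2) ^ m))) (by positivity)
    (fun HL HR hH D hsub hk => ?_)).trans_eq ?_
  · have hw : HL.card * HR.card ≤ k ^ 2 / 4 := by
      rw [Nat.le_div_iff_mul_le (by norm_num), ← hk]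
      zify
      nlinarith [sq_nonneg ((HL.card : ℤ) - HR.card)]
    have hLc : (Finset.univ.image Sum.inl : Finset (Fin ℓ ⊕ Fin r)).card = ℓ := by
      rw [Finset.card_image_of_injective _ Sum.inl_injective, Finset.card_univ, Fintype.card_fin]
    have hRc : (Finset.univ.image Sum.inr : Finset (Fin ℓ ⊕ Fin r)).card = r := by
      rw [Finset.card_image_of_injective _ Sum.inr_injective, Finset.card_univ, Fintype.card_fin]
    have hd : ∀ L R : Finset (Fin ℓ ⊕ Fin r), (HR ∩ L).card + (HL ∩ R).card ≤ k := fun L R => by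
      have h1 := Finset.card_le_card (Finset.inter_subset_left (s₁ := HR) (s₂ := L))
      have h2 := Finset.card_le_card (Finset.inter_subset_left (s₁ := HL) (s₂ := R))
      omega
    have hd' := hd (Finset.univ.image Sum.inl) (Finset.univ.image Sum.inr)
    refine (prob_not_isPivotMinor_le (K := r - k) (m := m) (n := n) (by omega) (by omega) hx hx2
      _ (disjoint_image_inl_inr ℓ r) hH D hsub hk hw rfl (by omega) (by omega)).trans ?_
    -- One `k` pays for the at most `k` switches; the other keeps the target out of the spare
    -- vertices.
    have : r - k - k = r - 2 * k := by omega
    rw [this]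
    gcongr
  · simp

end OrderedBipartiteGraph

/-! ### Numerical estimates -/

namespace OrderedBipartiteGraph

theorem logb_eight_div_seven_pos : 0 < Real.logb 2 (8 / 7) :=
  Real.logb_pos (by norm_num) (by norm_num)

/-- Rests on (8/7)^200 ≤ 2^39. It serves only to show C ≥ 2.81, the one property of the constant
that the rest of the proof needs. -/
theorem logb_eight_div_seven_le : Real.logb 2 (8 / 7) ≤ 39 / 200 := by
  rw [Real.logb_le_iff_le_rpow (by norm_num) (by norm_num)]
  have h1 : ((8 : ℝ) / 7) ^ 200 ≤ ((2 : ℝ) ^ (39 / 200 : ℝ)) ^ 200 := by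
    rw [← Real.rpow_mul_natCast (by norm_num)]
    norm_num
  exact le_of_pow_le_pow_left₀ (by norm_num) (by positivity) h1

theorem le_universalityConstant :
    281 / 100 ≤ 1 / (2 * Real.logb 2 (8 / 7)) + 1 / 4 := by
  have h1 : 256 / 100 ≤ 1 / (2 * Real.logb 2 (8 / 7)) := by
    have h0 := logb_eight_div_seven_pos
    have h2 := logb_eight_div_seven_le
    rw [le_div_iff₀ (by positivity)]
    linarith
  linarith

theorem pow_le_two_rpow {y a : ℝ} (hy : 0 ≤ y) {p q : ℕ} (hp : p ≠ 0)
    (h : y ^ p ≤ (1 / 2) ^ q) (ha : a = q / p) (m : ℕ) : y ^ m ≤ (2 : ℝ) ^ (-(a * m)) := by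
  have hp' : (p : ℝ) ≠ 0 := by exact_mod_cast hp
  have h1 : y ≤ (2 : ℝ) ^ (-a) := by
    refine le_of_pow_le_pow_left₀ hp (by positivity) (h.trans_eq ?_)
    rw [← Real.rpow_mul_natCast (by norm_num), ha, neg_mul, div_mul_cancel₀ _ hp',
      Real.rpow_neg (by norm_num), Real.rpow_natCast, one_div, inv_pow]
  refine (pow_le_pow_left₀ hy h1 m).trans_eq ?_
  rw [← Real.rpow_mul_natCast (by norm_num), neg_mul]

theorem one_sub_probUniversal_le_rpow {ℓ r k : ℕ} {C f : ℝ} (hr : 16 ≤ r) (hrℓ : r ≤ ℓ)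
    (hC : 281 / 100 ≤ C) (hkr : C * (k : ℝ) ^ 2 ≤ r) (hℓ : (ℓ : ℝ) ≤ (2 : ℝ) ^ f) :
    1 - probUniversal ℓ r k ≤
      (2 : ℝ) ^ (-((r : ℝ) / (4 * C) - (k : ℝ) ^ 2 / 4 - ((k : ℝ) * (5 + f) + 5))) := by
  have hr' : (16 : ℝ) ≤ r := by exact_mod_cast hr
  have hrℓ' : (r : ℝ) ≤ ℓ := by exact_mod_cast hrℓ
  have hk0 : (0 : ℝ) ≤ k := by positivity
  -- With r ≥ 16 this gives k² ≤ r ≤ (r/4)², leaving room for the `2 * k` reserved vertices.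
  have hk2 : 281 / 100 * (k : ℝ) ^ 2 ≤ r := le_trans (by gcongr) hkr
  have hkr' : (k : ℝ) ≤ 1 / 4 * r := by nlinarith
  have hk4 : 4 * k ≤ r := by
    have : (4 * k : ℝ) ≤ r := by linarith
    exact_mod_cast this
  set σ : ℝ := 1 / (4 * C) with hσ
  have hσ1 : σ ≤ 89 / 1000 := by
    rw [hσ, div_le_iff₀ (by linarith)]
    linarith
  have hkσ : (k : ℝ) ^ 2 / 4 ≤ σ * r := by
    rw [hσ, one_div, inv_mul_eq_div, le_div_iff₀ (by linarith)]
    linarith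
  -- The share 0.41 balances two errors: 2^m / 2^n decays at rate 0.5 - 0.41 = 0.09 and ((1 +
  -- x)/2)^m at rate 0.22 · 0.41 = 0.0902 per unit of `r`. Both exceed σ ≤ 0.089. The rank ≥ 3 error
  -- has rate 0.55 · 0.41 = 0.2255, enough to cover `σ` twice, since k²/4 ≤ σ r.
  set m := 41 * r / 100 with hm
  set n := r / 2 - k with hn
  have hm1 : (m : ℝ) ≤ 41 / 100 * r := by
    have : m * 100 ≤ 41 * r := Nat.div_mul_le_self _ _
    have : (m * 100 : ℝ) ≤ 41 * r := by exact_mod_cast this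
    linarith
  have hm2 : 41 / 100 * (r : ℝ) - 1 ≤ m := by
    have : 41 * r ≤ m * 100 + 100 := by omega
    have : (41 * r : ℝ) ≤ m * 100 + 100 := by exact_mod_cast this
    linarith
  have hn1 : (r : ℝ) / 2 - k - 1 ≤ n := by
    have : r ≤ 2 * n + 2 * k + 1 := by omega
    have : (r : ℝ) ≤ 2 * n + 2 * k + 1 := by exact_mod_cast this
    linarith
  have hx2 : (Real.sqrt (1 / 2)) ^ 2 = 1 / 2 := Real.sq_sqrt (by norm_num)
  set x := Real.sqrt (1 / 2) with hxdef
  have hx : 0 ≤ x := Real.sqrt_nonneg _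
  have hxle : x ≤ 70711 / 100000 := by
    rw [hxdef, Real.sqrt_le_left (by norm_num)]
    norm_num
  have hx3 : x ^ 3 ≤ 35356 / 100000 := by
    have : x ^ 3 = x / 2 := by rw [pow_succ, hx2]; ring
    rw [this]
    linarith
  set u : ℝ := -(σ * r) + 3 * k + 3 with hu
  have two_le : ∀ {a b : ℝ}, a ≤ b → (2 : ℝ) ^ a ≤ (2 : ℝ) ^ b := fun h =>
    Real.rpow_le_rpow_of_exponent_le (by norm_num) h
  have hpow : ∀ j : ℕ, (2 : ℝ) ^ j = (2 : ℝ) ^ (j : ℝ) := fun j => (Real.rpow_natCast _ _).symm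
  have hw : (2 : ℝ) ^ (k ^ 2 / 4) ≤ (2 : ℝ) ^ ((k : ℝ) ^ 2 / 4) := by
    rw [hpow]
    refine two_le (Nat.cast_div_le.trans_eq ?_)
    push_cast
    rfl
  have t1 : k * (1 / 2 : ℝ) ^ (r - 2 * k) ≤ (2 : ℝ) ^ u := by
    have h1 : (k : ℝ) ≤ (2 : ℝ) ^ (k : ℝ) := by
      rw [← hpow]; exact_mod_cast Nat.lt_two_pow_self.le
    have h2 : (1 / 2 : ℝ) ^ (r - 2 * k) = (2 : ℝ) ^ (-((r : ℝ) - 2 * k)) := by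
      rw [one_div, inv_pow, hpow, Nat.cast_sub (by omega), Real.rpow_neg (by norm_num)]
      push_cast
      rfl
    rw [h2]
    calc (k : ℝ) * (2 : ℝ) ^ (-((r : ℝ) - 2 * k))
        ≤ (2 : ℝ) ^ (k : ℝ) * (2 : ℝ) ^ (-((r : ℝ) - 2 * k)) := by gcongr
      _ = (2 : ℝ) ^ ((k : ℝ) + -((r : ℝ) - 2 * k)) := (Real.rpow_add (by norm_num) _ _).symm
      _ ≤ _ := two_le (by rw [hu]; nlinarith)
  have t2 : 2 * ((2 : ℝ) ^ m / 2 ^ n) ≤ (2 : ℝ) ^ u := by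
    rw [hpow m, hpow n, ← Real.rpow_sub (by norm_num)]
    calc 2 * (2 : ℝ) ^ ((m : ℝ) - n) = (2 : ℝ) ^ (1 + ((m : ℝ) - n)) := by
          rw [Real.rpow_add (by norm_num), Real.rpow_one]
      _ ≤ _ := two_le (by rw [hu]; nlinarith)
  have t3 : 2 ^ (2 * k) * ((1 + x) / 2) ^ m ≤ (2 : ℝ) ^ u := by
    have h1 : ((1 + x) / 2) ^ m ≤ (2 : ℝ) ^ (-((22 / 100 : ℝ) * m)) := by
      -- The rate 0.22 = 11/50 is certified by an integer power, as is 0.55 = 11/20 below.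
      refine pow_le_two_rpow (p := 50) (q := 11) (by positivity) (by norm_num) ?_ (by norm_num) m
      calc ((1 + x) / 2) ^ 50 ≤ (170711 / 200000 : ℝ) ^ 50 :=
            pow_le_pow_left₀ (by positivity) (by linarith) 50
        _ ≤ _ := by norm_num
    calc 2 ^ (2 * k) * ((1 + x) / 2) ^ m
        ≤ (2 : ℝ) ^ ((2 * k : ℕ) : ℝ) * (2 : ℝ) ^ (-((22 / 100 : ℝ) * m)) := by
          rw [hpow]; gcongr
      _ = (2 : ℝ) ^ (((2 * k : ℕ) : ℝ) + -((22 / 100 : ℝ) * m)) :=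
          (Real.rpow_add (by norm_num) _ _).symm
      _ ≤ _ := two_le (by rw [hu]; push_cast; nlinarith)
  have t4 : 2 ^ (k ^ 2 / 4) * ((1 + x ^ 3) / 2) ^ m ≤ (2 : ℝ) ^ u := by
    have h1 : ((1 + x ^ 3) / 2) ^ m ≤ (2 : ℝ) ^ (-((55 / 100 : ℝ) * m)) := by
      refine pow_le_two_rpow (p := 20) (q := 11) (by positivity) (by norm_num) ?_ (by norm_num) m
      calc ((1 + x ^ 3) / 2) ^ 20 ≤ (135356 / 200000 : ℝ) ^ 20 :=
            pow_le_pow_left₀ (by positivity) (by linarith) 20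
        _ ≤ _ := by norm_num
    calc 2 ^ (k ^ 2 / 4) * ((1 + x ^ 3) / 2) ^ m
        ≤ (2 : ℝ) ^ ((k : ℝ) ^ 2 / 4) * (2 : ℝ) ^ (-((55 / 100 : ℝ) * m)) := by gcongr
      _ = (2 : ℝ) ^ ((k : ℝ) ^ 2 / 4 + -((55 / 100 : ℝ) * m)) :=
          (Real.rpow_add (by norm_num) _ _).symm
      _ ≤ _ := two_le (by rw [hu]; nlinarith)
  have t0 : (2 * (ℓ + r : ℝ)) ^ k ≤ (2 : ℝ) ^ ((2 + f) * k) := by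
    rw [Real.rpow_mul_natCast (by norm_num), Real.rpow_add (by norm_num)]
    refine pow_le_pow_left₀ (by positivity) ?_ k
    norm_num
    linarith
  refine (one_sub_probUniversal_le hrℓ (m := m) (n := n) (by omega) (by omega) hx hx2).trans ?_
  calc _ ≤ (2 : ℝ) ^ ((2 + f) * k) * ((2 : ℝ) ^ ((k : ℝ) ^ 2 / 4) *
        ((2 : ℝ) ^ u + ((2 : ℝ) ^ u + ((2 : ℝ) ^ u + (2 : ℝ) ^ u)))) := by gcongr
    _ = (2 : ℝ) ^ ((2 + f) * k + ((k : ℝ) ^ 2 / 4 + (2 + u))) := by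
        rw [Real.rpow_add (by norm_num) ((2 + f) * k), Real.rpow_add (by norm_num) ((k : ℝ) ^ 2 / 4),
          Real.rpow_add (by norm_num) 2, show (2 : ℝ) ^ (2 : ℝ) = 4 by norm_num]
        ring
    _ = _ := by
        rw [hu, hσ]
        congr 1
        ring

theorem probUniversal_nonneg (ℓ r k : ℕ) : 0 ≤ probUniversal ℓ r k := ENNReal.toReal_nonneg

end OrderedBipartiteGraph

/-! ### The asymptotic statement -/

theorem mainTheorem4 (k ℓ r : ℕ → ℕ) (c f : ℕ → ℝ) (c₀ : ℝ) (hc₀ : 0 < c₀) (hc : ∀ n, c₀ ≤ c n)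
    (hr : Tendsto r atTop atTop)
    (hrℓ : ∀ n, r n ≤ ℓ n)
    (hkr : ∀ n, (1 + c n) * (1 / (2 * Real.logb 2 (8 / 7)) + 1 / 4) * (k n : ℝ) ^ 2 ≤ (r n : ℝ))
    (hf : f =o[atTop] fun n => Real.sqrt (r n))
    (hℓ : ∀ n, (ℓ n : ℝ) ≤ (2 : ℝ) ^ f n) :
    ∃ η : ℕ → ℝ, Tendsto η atTop (𝓝 0) ∧
      ∀ n, 1 - (2 : ℝ) ^ (-((1 + η n) * c n * (k n : ℝ) ^ 2 / 4)) ≤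
        OrderedBipartiteGraph.probUniversal (ℓ n) (r n) (k n) := by
  have hC := OrderedBipartiteGraph.le_universalityConstant
  set C : ℝ := 1 / (2 * Real.logb 2 (8 / 7)) + 1 / 4
  have hCpos : 0 < C := by linarith
  let t : ℕ → ℝ := fun n => (r n : ℝ) / (4 * C) - (k n : ℝ) ^ 2 / 4
  let g : ℕ → ℝ := fun n => Real.sqrt (r n) * (5 + f n) + 5
  have hk2 : ∀ n, (k n : ℝ) ^ 2 / 4 * (1 + c n) ≤ (r n : ℝ) / (4 * C) := fun n => by
    rw [le_div_iff₀ (by positivity)]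
    have := hkr n
    linarith
  have htc : ∀ n, c n * (k n : ℝ) ^ 2 / 4 ≤ t n := fun n => by
    have := hk2 n
    simp only [t]
    linarith
  -- The uniform lower bound on `c n` makes the main exponent `t n` at least `κ * r n`, so the error
  -- `g n` = o(r n) is negligible against it.
  set κ : ℝ := c₀ / (1 + c₀) / (4 * C) with hκ
  have hκpos : 0 < κ := by positivity
  have htr : ∀ n, κ * r n ≤ t n := fun n => by
    have h1 : (k n : ℝ) ^ 2 / 4 * (1 + c₀) ≤ (r n : ℝ) / (4 * C) := by
      refine le_trans ?_ (hk2 n)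
      have := hc n
      gcongr
    have h2 : (k n : ℝ) ^ 2 / 4 ≤ (r n : ℝ) / (4 * C) / (1 + c₀) := by
      rwa [le_div_iff₀ (by positivity)]
    have h3 : κ * r n = (r n : ℝ) / (4 * C) - (r n : ℝ) / (4 * C) / (1 + c₀) := by
      rw [hκ]
      field_simp
      ring
    simp only [t]
    linarith
  have hf0 : ∀ n, 16 ≤ r n → 0 ≤ f n := fun n hn => by
    have h1 : (1 : ℝ) ≤ (2 : ℝ) ^ f n := by
      refine le_trans ?_ (hℓ n)
      exact_mod_cast (show 1 ≤ 16 by norm_num).trans (hn.trans (hrℓ n))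
    by_contra! hneg
    exact absurd (Real.rpow_lt_one_of_one_lt_of_neg (by norm_num : (1 : ℝ) < 2) hneg) (not_lt.2 h1)
  have hrR : Tendsto (fun n => (r n : ℝ)) atTop atTop := tendsto_natCast_atTop_atTop.comp hr
  have hsqrt : Tendsto (fun n => Real.sqrt (r n)) atTop atTop := Real.tendsto_sqrt_atTop.comp hrR
  have hev : ∀ᶠ n in atTop, 16 ≤ r n := hr.eventually_ge_atTop 16
  have hgr : Tendsto (fun n => g n / r n) atTop (𝓝 0) := by
    have h1 : Tendsto (fun n => 5 / Real.sqrt (r n) + f n / Real.sqrt (r n) + 5 / (r n : ℝ)) atTop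
        (𝓝 (0 + 0 + 0)) :=
      ((hsqrt.const_div_atTop 5).add hf.tendsto_div_nhds_zero).add (hrR.const_div_atTop 5)
    rw [add_zero, add_zero] at h1
    refine h1.congr' ?_
    filter_upwards [hev] with n hn
    have hpos : (0 : ℝ) < r n := by exact_mod_cast (show 0 < 16 by norm_num).trans_le hn
    have hs : Real.sqrt (r n) ≠ 0 := (Real.sqrt_pos.2 hpos).ne'
    simp only [g]
    have h2 : (r n : ℝ) = Real.sqrt (r n) * Real.sqrt (r n) := (Real.mul_self_sqrt hpos.le).symm
    generalize Real.sqrt (r n) = s at hs h2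
    rw [h2]
    field_simp
  -- This choice gives (1 + η) t = t - g, and t dominates c k²/4. For the finitely many small `r n`,
  -- the value -1 makes the lower bound zero.
  refine ⟨fun n => if 16 ≤ r n then -(g n / t n) else -1, ?_, fun n => ?_⟩
  · have h1 : Tendsto (fun n => g n / t n) atTop (𝓝 0) := by
      have h2 : Tendsto (fun n => κ⁻¹ * (g n / r n)) atTop (𝓝 0) := by
        simpa using hgr.const_mul κ⁻¹
      refine squeeze_zero' ?_ ?_ h2
      · filter_upwards [hev] with n hn
        have := hf0 n hn
        have ht : 0 ≤ t n := le_trans (by positivity) (htr n)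
        simp only [g]
        positivity
      · filter_upwards [hev] with n hn
        have := hf0 n hn
        have hpos : (0 : ℝ) < r n := by exact_mod_cast (show 0 < 16 by norm_num).trans_le hn
        have hg : 0 ≤ g n := by simp only [g]; positivity
        calc g n / t n ≤ g n / (κ * r n) := by
              gcongr
              exact htr n
          _ = _ := by field_simp
    have h3 : Tendsto (fun n => -(g n / t n)) atTop (𝓝 0) := by simpa using h1.neg
    refine h3.congr' ?_
    filter_upwards [hev] with n hn
    rw [if_pos hn]
  · have hprob := OrderedBipartiteGraph.probUniversal_nonneg (ℓ n) (r n) (k n)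
    by_cases hn : 16 ≤ r n
    · simp only [if_pos hn]
      have hpos : (0 : ℝ) < r n := by exact_mod_cast (show 0 < 16 by norm_num).trans_le hn
      have ht : 0 < t n := lt_of_lt_of_le (by positivity) (htr n)
      have hcn : 0 < c n := hc₀.trans_le (hc n)
      have hck : 0 ≤ c n * (k n : ℝ) ^ 2 / 4 := by positivity
      have hfn := hf0 n hn
      have hCk : C * (k n : ℝ) ^ 2 ≤ r n := by
        refine le_trans ?_ (hkr n)
        have h1 : 0 ≤ c n * (C * (k n : ℝ) ^ 2) := by positivity
        linarith
      have hkn : (k n : ℝ) ≤ Real.sqrt (r n) := by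
        refine Real.le_sqrt_of_sq_le (le_trans ?_ hCk)
        nlinarith [sq_nonneg (k n : ℝ)]
      have key := OrderedBipartiteGraph.one_sub_probUniversal_le_rpow hn (hrℓ n) hC hCk (hℓ n)
      have hkg : (k n : ℝ) * (5 + f n) + 5 ≤ g n := by
        simp only [g]
        gcongr
      rcases le_or_gt (g n) (t n) with hgt | hgt
      · have h1 : (1 + -(g n / t n)) * c n * (k n : ℝ) ^ 2 / 4 ≤ t n - g n := by
          have h2 : 0 ≤ 1 + -(g n / t n) := by
            have := (div_le_one ht).2 hgt
            linarith
          calc (1 + -(g n / t n)) * c n * (k n : ℝ) ^ 2 / 4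
              = (1 + -(g n / t n)) * (c n * (k n : ℝ) ^ 2 / 4) := by ring
            _ ≤ (1 + -(g n / t n)) * t n := by
                gcongr
                exact htc n
            _ = t n - g n := by field_simp; ring
        have h3 := Real.rpow_le_rpow_of_exponent_le (by norm_num : (1 : ℝ) ≤ 2)
          (show -((r n : ℝ) / (4 * C) - (k n : ℝ) ^ 2 / 4 - ((k n : ℝ) * (5 + f n) + 5)) ≤
            -((1 + -(g n / t n)) * c n * (k n : ℝ) ^ 2 / 4) by
              have h4 : t n = (r n : ℝ) / (4 * C) - (k n : ℝ) ^ 2 / 4 := rfl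
              rw [h4] at h1
              rw [h4]
              linarith)
        linarith
      -- Here 1 + η is negative, so the claimed lower bound is at most zero.
      · have h1 : (1 + -(g n / t n)) * c n * (k n : ℝ) ^ 2 / 4 ≤ 0 := by
          have h2 : 1 + -(g n / t n) ≤ 0 := by
            have := (one_lt_div ht).2 hgt
            linarith
          have h3 := mul_nonpos_of_nonpos_of_nonneg h2 hck
          calc _ = (1 + -(g n / t n)) * (c n * (k n : ℝ) ^ 2 / 4) := by ring
            _ ≤ 0 := h3
        have h4 := Real.one_le_rpow (by norm_num : (1 : ℝ) ≤ 2) (neg_nonneg.2 h1)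
        linarith
    · simp only [if_neg hn]
      simpa using hprob
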